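/- Let $k=\mathbf F_q$ be a finite field, let $n,d\ge 0$ be integers, and let $X$ be a closed subscheme of $\mathbf P^n_k$ of dimension $d$. Then the set $X(\mathbf F_q)$ of $\mathbf F_q$-rational points of $X$ is finite and $$\# X(\mathbf F_q)\;\le\;\#\mathbf P^d(\mathbf F_q)\cdot\deg X .$$ Here $X$ is not assumed to be reduced, irreducible or equidimensional, and $\deg X$ is the degree of the fundamental cycle of $X$: $\deg X=\sum_i m_i\deg X_i$, where $X_i$ runs over all irreducible components of $X$ (with reduced structure), $m_i$ is the length of the local ring of $X$ at the generic point of $X_i$, and $\deg X_i$ is the usual degree of the integral closed subscheme $X_i\subset\mathbf P^n_k$, that is, $(\dim X_i)!$ times the leading coefficient of its Hilbert polynomial. (When $X$ is equidimensional this is the usual degree of $X$.) -/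

import Mathlib

open AlgebraicGeometry CategoryTheory

universe u

attribute [local instance] MvPolynomial.gradedAlgebra

noncomputable section

namespace ProjDegree

/-- Projective space `ℙⁿ` over the field `k`, as the scheme `Proj k[x₀, …, xₙ]`. -/
abbrev projSpace (n : ℕ) (k : Type u) [Field k] : Scheme.{u} :=
  Proj (MvPolynomial.homogeneousSubmodule (Fin (n + 1)) k)

/-- The structure morphism `ℙⁿ ⟶ Spec k`. -/
def projSpaceStr (n : ℕ) (k : Type u) [Field k] : projSpace n k ⟶ Spec (CommRingCat.of k) :=
  Proj.toSpecZero (MvPolynomial.homogeneousSubmodule (Fin (n + 1)) k) ≫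
    Spec.map (CommRingCat.ofHom
      (algebraMap k (MvPolynomial.homogeneousSubmodule (Fin (n + 1)) k 0)))

/-- The set `X(k)` of `k`-rational points of a scheme over `k`: sections of the structure
morphism `s : X ⟶ Spec k`. -/
def RationalPoints {k : Type u} [Field k] {X : Scheme.{u}} (s : X ⟶ Spec (CommRingCat.of k)) :
    Type u :=
  { f : Spec (CommRingCat.of k) ⟶ X // f ≫ s = 𝟙 (Spec (CommRingCat.of k)) }

/-- The Hilbert function `m ↦ dim_k (S / I)_m` of the ring `S / I`, where `S = k[x₀, …, xₙ]` and
`I` is a homogeneous ideal of `S`; here `(S / I)_m` is the image of `S_m` in `S / I`. -/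
def hilbertFunction {n : ℕ} {k : Type u} [Field k]
    (I : Ideal (MvPolynomial (Fin (n + 1)) k)) (m : ℕ) : ℕ :=
  Module.finrank k ((MvPolynomial.homogeneousSubmodule (Fin (n + 1)) k m).map
    (Ideal.Quotient.mkₐ k I).toLinearMap)

/-- `p` is a Hilbert polynomial of `S / I`: it agrees with the Hilbert function in all large
degrees. -/
def IsHilbertPolynomial {n : ℕ} {k : Type u} [Field k]
    (I : Ideal (MvPolynomial (Fin (n + 1)) k)) (p : Polynomial ℚ) : Prop :=
  ∀ᶠ m : ℕ in Filter.atTop, p.eval (m : ℚ) = (hilbertFunction I m : ℚ)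

theorem IsHilbertPolynomial.unique {n : ℕ} {k : Type u} [Field k]
    {I : Ideal (MvPolynomial (Fin (n + 1)) k)} {p p' : Polynomial ℚ}
    (h : IsHilbertPolynomial I p) (h' : IsHilbertPolynomial I p') : p = p' := by
  obtain ⟨N, hN⟩ := Filter.eventually_atTop.mp (h.and h')
  refine Polynomial.eq_of_infinite_eval_eq p p' (Set.Infinite.mono (s := (fun m : ℕ => (m : ℚ)) ''
    Set.Ici N) ?_ ((Set.Ici_infinite N).image Nat.cast_injective.injOn))
  rintro _ ⟨m, hm, rfl⟩
  exact (hN m hm).1.trans (hN m hm).2.symm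

open Classical in
/-- The Hilbert polynomial of `S / I` (with value `0` should there be none; by the theorem of
Hilbert and Serre there always is one when `I` is homogeneous). -/
def hilbertPolynomial {n : ℕ} {k : Type u} [Field k]
    (I : Ideal (MvPolynomial (Fin (n + 1)) k)) : Polynomial ℚ :=
  if h : ∃ p : Polynomial ℚ, IsHilbertPolynomial I p then h.choose else 0

/-- The degree of the integral closed subscheme `closure {z} = Proj (S / 𝔭)` of `ℙⁿ`, where `𝔭` is
the homogeneous prime ideal of the point `z`: if the Hilbert polynomial of `S / 𝔭` has degree `r`
(which is the dimension of `closure {z}`), it is `r!` times its leading coefficient. -/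
def degreeOfClosure {n : ℕ} {k : Type u} [Field k] (z : projSpace n k) : ℚ :=
  ((hilbertPolynomial z.asHomogeneousIdeal.toIdeal).natDegree.factorial : ℚ) *
    (hilbertPolynomial z.asHomogeneousIdeal.toIdeal).leadingCoeff

/-- The multiplicity of the irreducible component of `X` with generic point `x`: the length of the
local ring of `X` at `x`. -/
def multiplicity (X : Scheme.{u}) (x : X) : ℕ :=
  (Module.length (X.presheaf.stalk x) (X.presheaf.stalk x)).toNat

/-- The degree of a closed subscheme `i : X ⟶ ℙⁿ`, namely the degree of its fundamental cycle:
the sum over all irreducible components of `X`, indexed by their generic points, of the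
multiplicity times the degree of the component in `ℙⁿ`. -/
def degree {n : ℕ} {k : Type u} [Field k] {X : Scheme.{u}} (i : X ⟶ projSpace n k) : ℚ :=
  ∑ᶠ x : genericPoints X, (multiplicity X x.1 : ℚ) * degreeOfClosure (i x.1)

end ProjDegree

end

/-! Write q for the cardinality of k and S for the polynomial ring. Rational points are counted on
affine cones: each is a class of q - 1 proportional nonzero vectors in kⁿ⁺¹, so it suffices to
bound, for the homogeneous prime p of each component, the number of nonzero zeros of p by (q^(r+1) -
1) deg p, where r is the dimension of Proj (S / p). The components are then summed, using r ≤ d and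
that every multiplicity is at least 1.

The engine is slicing by hyperplanes. If a linear form f is not in p, all components of the section
p + (f) have dimension r - 1, and their degrees add up to at most deg p (`sum_idealDegree_le`). Off
a hyperplane xᵢ = 0, the cone is either met in at most q - 1 vectors, or covered by the q slices xⱼ
= a xᵢ for some j; induction on r gives (q - 1) q^r deg p (`ncard_zeros_inter_ne_zero_le`). Adding
the section by xᵢ = 0, for an i with Xᵢ outside p, gives the projective bound, because (q - 1) q^r +
(q^r - 1) = q^(r+1) - 1 (`ncard_zeros_diff_zero_le`).

Additivity of degrees comes from the exact sequence 0 → (S / (I : f))(-e) → S / I → S / (I + (f)) →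
0 for f of degree e. Purity of the section comes from Krull's principal ideal theorem and Noether
normalization, once the degree of the Hilbert polynomial is identified with the Krull dimension of S
/ p minus one. -/

/-! ### Krull dimension of hypersurface sections of finitely generated algebras -/

theorem MvPolynomial.height_eq_of_isMaximal {k : Type*} [Field k] (s : ℕ)
    (M : Ideal (MvPolynomial (Fin s) k)) [M.IsMaximal] : M.height = s := by
  induction s with
  | zero =>
    have h : ringKrullDim (MvPolynomial (Fin 0) k) = 0 := by simp
    have := M.height_le_ringKrullDim_of_ne_top (Ideal.IsMaximal.ne_top inferInstance)
    rw [h] at this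
    simpa using this
  | succ s ih =>
    let e := (MvPolynomial.finSuccEquiv k s).toRingEquiv
    rw [← RingEquiv.height_comap e.symm]
    have : (M.comap e.symm).IsMaximal := Ideal.comap_isMaximal_of_equiv e.symm
    set N : Ideal (Polynomial (MvPolynomial (Fin s) k)) := M.comap e.symm
    -- A polynomial ring over a field is a Jacobson ring, so maximal ideals contract to maximal
    -- ideals and the induction applies.
    have : (N.under (MvPolynomial (Fin s) k)).IsMaximal := by
      exact Polynomial.isMaximal_comap_C_of_isJacobsonRing N
    have : N.LiesOver (N.under (MvPolynomial (Fin s) k)) := ⟨rfl⟩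
    rw [Polynomial.height_eq_height_add_one (N.under (MvPolynomial (Fin s) k)) N, ih]
    simp

theorem MvPolynomial.le_ringKrullDim_quotient_span_singleton {k : Type*} [Field k] (s : ℕ)
    {g : MvPolynomial (Fin s) k} (hg : ¬ IsUnit g) :
    (s : WithBot ℕ∞) ≤ ringKrullDim (MvPolynomial (Fin s) k ⧸ Ideal.span {g}) + 1 := by
  obtain ⟨M, hM, hgM⟩ := exists_max_ideal_of_mem_nonunits hg
  have h := Ideal.height_le_ringKrullDim_quotient_add_one (p := M) hgM
  rw [MvPolynomial.height_eq_of_isMaximal] at h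
  exact_mod_cast h

theorem ringKrullDim_le_of_isIntegral {B A : Type*} [CommRing B] [CommRing A] [Algebra B A]
    [Algebra.IsIntegral B A] : ringKrullDim A ≤ ringKrullDim B :=
  Order.krullDim_le_of_strictMono (PrimeSpectrum.comap (algebraMap B A)) fun _ _ h ↦
    Ideal.IsIntegral.comap_lt_comap h

/-- Going up: a chain of primes of B / (Q ∩ B) lifts to a chain of the same length in A / Q,
starting from a prime over its first member. -/
theorem ringKrullDim_quotient_under_le {B A : Type*} [CommRing B] [CommRing A] [Algebra B A]
    [Algebra.IsIntegral B A] (Q : Ideal A) [Q.IsPrime] :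
    ringKrullDim (B ⧸ Q.under B) ≤ ringKrullDim (A ⧸ Q) := by
  refine iSup_le fun l ↦ ?_
  have hlo : (⊥ : Ideal (A ⧸ Q)).LiesOver (⊥ : Ideal (B ⧸ Q.under B)) :=
    ⟨((RingHom.injective_iff_ker_eq_bot _).mp
      (FaithfulSMul.algebraMap_injective (B ⧸ Q.under B) (A ⧸ Q))).symm⟩
  obtain ⟨P, -, hP, hPl⟩ := Ideal.exists_ideal_ge_liesOver_of_le (p := ⊥)
    (q := l.head.asIdeal) (⊥ : Ideal (A ⧸ Q)) bot_le
  obtain ⟨L, hL, -⟩ := Ideal.exists_ltSeries_of_hasGoingUp l P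
  rw [← hL]
  exact le_iSup (fun L : LTSeries (PrimeSpectrum (A ⧸ Q)) ↦ (L.length : WithBot ℕ∞)) L

/-- Noether normalization makes A integral over a polynomial ring B. By going down, q = Q ∩ B has
height at most one; it is nonzero, hence principal because B is factorial. In B a principal quotient
loses at most one dimension, and B / q has dimension at most that of A / Q. -/
theorem ringKrullDim_le_quotient_add_one {k A : Type*} [Field k] [CommRing A] [IsDomain A]
    [Algebra k A] [Algebra.FiniteType k A] (Q : Ideal A) [Q.IsPrime] (hQ : Q.height ≤ 1) (hQ0 : Q ≠ ⊥) :
    ringKrullDim A ≤ ringKrullDim (A ⧸ Q) + 1 := by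
  obtain ⟨s, g, hg, hfin⟩ := exists_integral_inj_algHom_of_fg k A
  algebraize [g.toRingHom]
  have : FaithfulSMul (MvPolynomial (Fin s) k) A := (faithfulSMul_iff_algebraMap_injective _ _).mpr hg
  have : IsNoetherianRing A := Algebra.FiniteType.isNoetherianRing k A
  have h1 : ringKrullDim A ≤ s := by
    refine (ringKrullDim_le_of_isIntegral (B := MvPolynomial (Fin s) k)).trans ?_
    simp
  set q := Q.under (MvPolynomial (Fin s) k)
  have hq : q.height ≤ 1 := by
    rw [Ideal.height_eq_height_add_of_liesOver_of_hasGoingDown q Q] at hQ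
    exact le_self_add.trans hQ
  have hq0 : q ≠ ⊥ := by
    obtain ⟨x, hx, hx0⟩ := Submodule.exists_mem_ne_zero_of_ne_bot hQ0
    exact Ideal.comap_ne_bot_of_integral_mem hx0 hx (Algebra.IsIntegral.isIntegral x)
  have hq1 : q.height = 1 := le_antisymm hq (by
    rw [Order.one_le_iff_ne_zero]
    exact fun h ↦ hq0 (Ideal.height_eq_zero_iff_eq_bot.mp h))
  obtain ⟨f, hf⟩ := (UniqueFactorizationMonoid.isPrincipal_of_height_eq_one hq1).principal
  have hfu : ¬ IsUnit f := fun h ↦ Ideal.IsPrime.ne_top (I := q) inferInstance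
    (hf.trans (Ideal.span_singleton_eq_top.mpr h))
  have h2 := MvPolynomial.le_ringKrullDim_quotient_span_singleton s hfu
  have h3 := ringKrullDim_quotient_under_le (B := MvPolynomial (Fin s) k) Q
  change ringKrullDim (_ ⧸ q) ≤ _ at h3
  rw [hf] at h3
  exact h1.trans (h2.trans (by gcongr))

/-- In the domain R / p the image of Q has height at most one by Krull's principal ideal theorem, so
the dimension drops by at most one; it does drop since the image of f is a nonzerodivisor. -/
theorem ringKrullDim_quotient_eq_of_mem_minimalPrimes {k R : Type*} [Field k] [CommRing R]
    [Algebra k R] [Algebra.FiniteType k R] {p Q : Ideal R} [p.IsPrime] {f : R} (hf : f ∉ p)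
    (hQ : Q ∈ (p ⊔ Ideal.span {f}).minimalPrimes) :
    ringKrullDim (R ⧸ p) = ringKrullDim (R ⧸ Q) + 1 := by
  have : IsNoetherianRing R := Algebra.FiniteType.isNoetherianRing k R
  have hQp : Q.IsPrime := hQ.isPrime
  have hpQ : p ≤ Q := le_sup_left.trans hQ.le
  have hfQ : f ∈ Q := hQ.le (Ideal.mem_sup_right (Ideal.mem_span_singleton_self f))
  set Q' := Q.map (Ideal.Quotient.mk p)
  have hQ' : Q'.IsPrime := Ideal.map_isPrime_of_surjective Ideal.Quotient.mk_surjective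
    (by rwa [Ideal.mk_ker])
  have hfQ' : Ideal.Quotient.mk p f ∈ Q' := Ideal.mem_map_of_mem _ hfQ
  have hf0 : Ideal.Quotient.mk p f ≠ 0 := fun h ↦ hf (Ideal.Quotient.eq_zero_iff_mem.mp h)
  have e : ringKrullDim ((R ⧸ p) ⧸ Q') = ringKrullDim (R ⧸ Q) :=
    ringKrullDim_eq_of_ringEquiv (DoubleQuot.quotQuotEquivQuotOfLE hpQ)
  rw [← e]
  refine le_antisymm (ringKrullDim_le_quotient_add_one (k := k) Q'
    (Ideal.map_height_le_one_of_mem_minimalPrimes hQ) fun h ↦ hf0 (by simpa [h] using hfQ')) ?_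
  exact ringKrullDim_succ_le_of_surjective (Ideal.Quotient.mk Q') Ideal.Quotient.mk_surjective
    (mem_nonZeroDivisors_of_ne_zero hf0) (Ideal.Quotient.eq_zero_iff_mem.mpr hfQ')

/-! ### Hilbert functions and existence of Hilbert polynomials -/

namespace ProjDegree

/-- The grading of `k[x₀, …, xₙ]` by the total degree. -/
abbrev gr (n : ℕ) (k : Type u) [Field k] : ℕ → Submodule k (MvPolynomial (Fin (n + 1)) k) :=
  MvPolynomial.homogeneousSubmodule (Fin (n + 1)) k

variable {n : ℕ} {k : Type u} [Field k] {I J : Ideal (MvPolynomial (Fin (n + 1)) k)}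

instance finiteDimensional_gr (m : ℕ) : FiniteDimensional k (gr n k m) :=
  Module.Finite.iff_fg.mpr (MvPolynomial.homogeneousSubmodule_fg _ _ m)

theorem X_mem_gr (i : Fin (n + 1)) : (MvPolynomial.X i : MvPolynomial (Fin (n + 1)) k) ∈ gr n k 1 :=
  MvPolynomial.isHomogeneous_X k i

/-- The degree `m` part of `S / I`. -/
noncomputable abbrev quotGr (I : Ideal (MvPolynomial (Fin (n + 1)) k)) (m : ℕ) :
    Submodule k (MvPolynomial (Fin (n + 1)) k ⧸ I) :=
  (gr n k m).map (Ideal.Quotient.mkₐ k I).toLinearMap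

theorem hilbertFunction_anti (h : I ≤ J) (m : ℕ) : hilbertFunction J m ≤ hilbertFunction I m := by
  have : quotGr J m = (quotGr I m).map (Ideal.Quotient.factorₐ k h).toLinearMap := by
    rw [quotGr, quotGr, ← Submodule.map_comp]
    rfl
  change Module.finrank k (quotGr J m) ≤ _
  rw [this]
  exact Submodule.finrank_map_le _ _

theorem hilbertFunction_eq_zero {m : ℕ} (h : ∀ f ∈ gr n k m, f ∈ I) : hilbertFunction I m = 0 := by
  have : quotGr I m = ⊥ := by
    rw [eq_bot_iff]
    rintro _ ⟨f, hf, rfl⟩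
    exact (Submodule.mem_bot k).mpr (Ideal.Quotient.eq_zero_iff_mem.mpr (h f hf))
  change Module.finrank k (quotGr I m) = 0
  rw [this, finrank_bot]

theorem hilbertFunction_pos {m : ℕ} {f : MvPolynomial (Fin (n + 1)) k} (hf : f ∈ gr n k m)
    (hfI : f ∉ I) : 0 < hilbertFunction I m := by
  change 0 < Module.finrank k (quotGr I m)
  rw [Module.finrank_pos_iff]
  refine ⟨⟨⟨_, f, hf, rfl⟩, 0, fun h ↦ hfI ?_⟩⟩
  exact Ideal.Quotient.eq_zero_iff_mem.mp congr(($h : _ ⧸ I))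

theorem decompose_mem (hI : I.IsHomogeneous (gr n k)) {f : MvPolynomial (Fin (n + 1)) k}
    (hf : f ∈ I) (m : ℕ) : (DirectSum.decompose (gr n k) f m : MvPolynomial (Fin (n + 1)) k) ∈ I :=
  hI m hf

theorem isHomogeneous_sup_span (hI : I.IsHomogeneous (gr n k)) {f : MvPolynomial (Fin (n + 1)) k}
    {e : ℕ} (hf : f ∈ gr n k e) : (I ⊔ Ideal.span {f}).IsHomogeneous (gr n k) :=
  hI.sup (Ideal.homogeneous_span _ _ fun x hx ↦ ⟨e, by rwa [Set.mem_singleton_iff.mp hx]⟩)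

theorem isHomogeneous_colon (hI : I.IsHomogeneous (gr n k)) {f : MvPolynomial (Fin (n + 1)) k}
    {e : ℕ} (hf : f ∈ gr n k e) : (I.colon {f}).IsHomogeneous (gr n k) := by
  intro i a ha
  rw [Submodule.mem_colon_singleton, smul_eq_mul] at ha ⊢
  have := decompose_mem hI ha (i + e)
  rwa [DirectSum.coe_decompose_mul_add_of_right_mem _ hf] at this

/-- Multiplication by f identifies S / (I : f), shifted by e, with the kernel of S / I → S / (I +
(f)); dimensions are counted in degree m + e. -/
theorem hilbertFunction_add (hI : I.IsHomogeneous (gr n k)) {f : MvPolynomial (Fin (n + 1)) k}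
    {e : ℕ} (hf : f ∈ gr n k e) (m : ℕ) : hilbertFunction I (m + e) =
      hilbertFunction (I ⊔ Ideal.span {f}) (m + e) + hilbertFunction (I.colon {f}) m := by
  let π : MvPolynomial (Fin (n + 1)) k ⧸ I →ₗ[k] MvPolynomial (Fin (n + 1)) k ⧸ (I ⊔ Ideal.span {f}) :=
    (Ideal.Quotient.factorₐ k le_sup_left).toLinearMap
  let T : gr n k m →ₗ[k] MvPolynomial (Fin (n + 1)) k ⧸ I :=
    (Ideal.Quotient.mkₐ k I).toLinearMap ∘ₗ (LinearMap.mulRight k f) ∘ₗ (gr n k m).subtype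
  let U : gr n k m →ₗ[k] MvPolynomial (Fin (n + 1)) k ⧸ (I.colon {f}) :=
    (Ideal.Quotient.mkₐ k (I.colon {f})).toLinearMap ∘ₗ (gr n k m).subtype
  have hU : LinearMap.range U = quotGr (I.colon {f}) m := by
    rw [LinearMap.range_comp, Submodule.range_subtype]
  have hker : LinearMap.ker T = LinearMap.ker U := by
    ext a
    simp only [LinearMap.mem_ker, T, U, LinearMap.comp_apply, Submodule.subtype_apply,
      LinearMap.mulRight_apply, AlgHom.toLinearMap_apply, Ideal.Quotient.mkₐ_eq_mk,
      Ideal.Quotient.eq_zero_iff_mem, Submodule.mem_colon_singleton, smul_eq_mul]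
  have h1 : Module.finrank k (LinearMap.range T) = hilbertFunction (I.colon {f}) m := by
    have a := LinearMap.finrank_range_add_finrank_ker T
    have b := LinearMap.finrank_range_add_finrank_ker U
    rw [hker] at a
    rw [hU] at b
    change _ = Module.finrank k (quotGr (I.colon {f}) m)
    omega
  let ρ := π.domRestrict (quotGr I (m + e))
  have h2 : LinearMap.range ρ = quotGr (I ⊔ Ideal.span {f}) (m + e) := by
    rw [LinearMap.range_domRestrict, quotGr, ← Submodule.map_comp]
    rfl
  have h3 : (LinearMap.ker ρ).map (quotGr I (m + e)).subtype = LinearMap.range T := by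
    ext y
    constructor
    · rintro ⟨⟨_, g, hg, rfl⟩, hy, rfl⟩
      have hy' : g ∈ I ⊔ Ideal.span {f} := Ideal.Quotient.eq_zero_iff_mem.mp hy
      obtain ⟨a, ha, b, hb, rfl⟩ := Submodule.mem_sup.mp hy'
      obtain ⟨c, rfl⟩ := Ideal.mem_span_singleton'.mp hb
      -- If g = a + c f is homogeneous of degree m + e, then modulo I it equals the degree m
      -- component of c times f.
      refine ⟨DirectSum.decompose (gr n k) c m, ?_⟩
      have hd := DirectSum.decompose_of_mem_same _ hg
      rw [DirectSum.decompose_add, DirectSum.add_apply, Submodule.coe_add,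
        DirectSum.coe_decompose_mul_add_of_right_mem _ hf] at hd
      change Ideal.Quotient.mk I _ = Ideal.Quotient.mk I (a + c * f)
      rw [← hd, map_add, Ideal.Quotient.eq_zero_iff_mem.mpr (decompose_mem hI ha _), zero_add]
      rfl
    · rintro ⟨a, rfl⟩
      refine ⟨⟨_, a * f, SetLike.mul_mem_graded a.2 hf, rfl⟩, ?_, rfl⟩
      exact Ideal.Quotient.eq_zero_iff_mem.mpr
        (Ideal.mem_sup_right (Ideal.mul_mem_left _ _ (Ideal.mem_span_singleton_self f)))
  have h4 : Module.finrank k (LinearMap.ker ρ) = Module.finrank k (LinearMap.range T) := by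
    rw [← h3]
    exact (LinearEquiv.finrank_eq (Submodule.equivMapOfInjective _ (Submodule.subtype_injective _) _))
  have h5 := LinearMap.finrank_range_add_finrank_ker ρ
  rw [h2, h4, h1] at h5
  exact h5.symm

theorem colon_singleton_eq_self [hI : I.IsPrime] {f : MvPolynomial (Fin (n + 1)) k} (hf : f ∉ I) :
    I.colon {f} = I := by
  ext a
  rw [Submodule.mem_colon_singleton, smul_eq_mul]
  exact ⟨fun h ↦ (hI.mem_or_mem h).resolve_right hf, fun h ↦ I.mul_mem_right _ h⟩

/-- Discrete integration: the Bernoulli polynomials satisfy B(x + 1) - B(x) = (d + 1) x^d in index d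
+ 1. -/
theorem _root_.Polynomial.exists_taylor_one_sub_self (q : Polynomial ℚ) :
    ∃ p : Polynomial ℚ, Polynomial.taylor 1 p - p = q := by
  induction q using Polynomial.induction_on' with
  | add q₁ q₂ h₁ h₂ =>
    obtain ⟨p₁, rfl⟩ := h₁
    obtain ⟨p₂, rfl⟩ := h₂
    exact ⟨p₁ + p₂, by rw [map_add]; ring⟩
  | monomial d a =>
    refine ⟨Polynomial.C (a / (d + 1)) * Polynomial.bernoulli (d + 1), Polynomial.funext fun x ↦ ?_⟩
    have := Polynomial.bernoulli_eval_one_add (d + 1) x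
    have hd : (d : ℚ) + 1 ≠ 0 := by positivity
    simp only [Polynomial.taylor_mul, Polynomial.taylor_C, Polynomial.eval_sub, Polynomial.eval_mul,
      Polynomial.eval_C, Polynomial.taylor_eval, Polynomial.eval_monomial, add_comm x 1, this]
    push_cast
    field_simp
    ring

/-- A homogeneous element of positive degree lies in each ideal that contains the variables. -/
theorem mem_of_X_mem (h : ∀ i, MvPolynomial.X i ∈ I) {m : ℕ} (hm : m ≠ 0)
    {f : MvPolynomial (Fin (n + 1)) k} (hf : f ∈ gr n k m) : f ∈ I := by
  rw [f.as_sum]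
  refine Ideal.sum_mem _ fun d hd ↦ ?_
  have hdeg : d.degree = m := by
    by_contra hne
    exact MvPolynomial.mem_support_iff.mp hd (MvPolynomial.IsHomogeneous.coeff_eq_zero hf hne)
  obtain ⟨i, hi⟩ : ∃ i, d i ≠ 0 := by
    by_contra! h0
    apply hm
    rw [← hdeg, show d = 0 from Finsupp.ext h0]
    rfl
  rw [MvPolynomial.monomial_eq]
  refine Ideal.mul_mem_left _ _ ?_
  rw [Finsupp.prod_fintype _ _ (fun _ ↦ pow_zero _)]
  refine Ideal.mem_of_dvd _ (Finset.dvd_prod_of_mem _ (Finset.mem_univ i)) ?_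
  exact Ideal.pow_mem_of_mem _ (h i) _ (Nat.pos_of_ne_zero hi)

/-- Noetherian induction on homogeneous ideals: it is enough to treat prime ideals and to pass
from the ideals `I + (f)` and `(I : f)` to `I` in the case that both are greater than `I`. -/
theorem homogeneous_induction {P : Ideal (MvPolynomial (Fin (n + 1)) k) → Prop} (htop : P ⊤)
    (hprime : ∀ I, I.IsHomogeneous (gr n k) → I.IsPrime →
      (∀ J, J.IsHomogeneous (gr n k) → I < J → P J) → P I)
    (hcolon : ∀ I (e : ℕ) (f : MvPolynomial (Fin (n + 1)) k), I.IsHomogeneous (gr n k) →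
      f ∈ gr n k e → P (I ⊔ Ideal.span {f}) → P (I.colon {f}) → P I)
    (I : Ideal (MvPolynomial (Fin (n + 1)) k)) (hI : I.IsHomogeneous (gr n k)) : P I := by
  revert hI
  refine IsNoetherian.induction (P := fun I : Ideal (MvPolynomial (Fin (n + 1)) k) ↦
    I.IsHomogeneous (gr n k) → P I) ?_ I
  intro (I : Ideal (MvPolynomial (Fin (n + 1)) k)) ih hI
  by_cases hp : I.IsPrime
  · exact hprime I hI hp fun J hJ hlt ↦ ih J hlt hJ
  · rw [hI.isPrime_iff] at hp
    by_cases hI1 : I = ⊤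
    · rwa [hI1]
    · push Not at hp
      -- Primality of a homogeneous ideal is tested on homogeneous elements. With a b in I and a, b
      -- outside I, the element a enlarges I + (a) and b enlarges (I : a).
      obtain ⟨a, b, ⟨e, ha⟩, -, hab, haI, hbI⟩ := hp hI1
      refine hcolon I e a hI ha (ih _ ?_ (isHomogeneous_sup_span hI ha))
        (ih _ ?_ (isHomogeneous_colon hI ha))
      · exact lt_of_le_of_ne le_sup_left fun h ↦ haI
          (h ▸ Ideal.mem_sup_right (Ideal.mem_span_singleton_self a))
      · refine lt_of_le_of_ne (fun x hx ↦ ?_) fun h ↦ hbI ?_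
        · rw [Submodule.mem_colon_singleton, smul_eq_mul]
          exact I.mul_mem_right _ hx
        · rw [h, Submodule.mem_colon_singleton, smul_eq_mul, mul_comm]
          exact hab

theorem IsHilbertPolynomial.add (hI : I.IsHomogeneous (gr n k))
    {f : MvPolynomial (Fin (n + 1)) k} {e : ℕ} (hf : f ∈ gr n k e) {p q : Polynomial ℚ}
    (hp : IsHilbertPolynomial (I ⊔ Ideal.span {f}) p) (hq : IsHilbertPolynomial (I.colon {f}) q) :
    IsHilbertPolynomial I (p + Polynomial.taylor (-(e : ℚ)) q) := by
  have hq' := (Filter.tendsto_sub_atTop_nat e).eventually hq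
  filter_upwards [hp, hq', Filter.eventually_ge_atTop e] with m h1 h2 hm
  obtain ⟨m, rfl⟩ := Nat.exists_eq_add_of_le' hm
  rw [hilbertFunction_add hI hf]
  rw [Nat.add_sub_cancel] at h2
  push_cast at h1 ⊢
  rw [← h1, ← h2]
  simp [Polynomial.taylor_eval]

theorem exists_isHilbertPolynomial (hI : I.IsHomogeneous (gr n k)) :
    ∃ p, IsHilbertPolynomial I p := by
  refine homogeneous_induction (P := fun I ↦ ∃ p, IsHilbertPolynomial I p) ?_
    (fun I hI hp ih ↦ ?_) (fun I e f hI hf h1 h2 ↦ ?_) I hI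
  · exact ⟨0, .of_forall fun m ↦ by
      rw [hilbertFunction_eq_zero fun _ _ ↦ Submodule.mem_top]; simp⟩
  · by_cases h : ∀ i, MvPolynomial.X i ∈ I
    · refine ⟨0, ?_⟩
      filter_upwards [Filter.eventually_ne_atTop 0] with m hm
      rw [hilbertFunction_eq_zero fun f ↦ mem_of_X_mem h hm]
      simp
    · push Not at h
      obtain ⟨i, hi⟩ := h
      obtain ⟨q, hq⟩ := ih _ (isHomogeneous_sup_span hI (X_mem_gr i)) (lt_of_le_of_ne le_sup_left
        fun h ↦ hi (h ▸ Ideal.mem_sup_right (Ideal.mem_span_singleton_self _)))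
      -- As (I : Xᵢ) = I, the Hilbert function has H(m + 1) - H(m) eventually equal to q(m + 1). A
      -- discrete primitive of this, corrected by a constant to agree with H at N, is the Hilbert
      -- polynomial.
      obtain ⟨p, hp⟩ := Polynomial.exists_taylor_one_sub_self (Polynomial.taylor 1 q)
      obtain ⟨N, hN⟩ := Filter.eventually_atTop.mp hq
      refine ⟨p + Polynomial.C (hilbertFunction I N - p.eval (N : ℚ)), ?_⟩
      refine Filter.eventually_atTop.mpr ⟨N, fun m hm ↦ ?_⟩
      induction m, hm using Nat.le_induction with
      | base => simp
      | succ m hm ih' =>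
        have h1 := hilbertFunction_add hI (X_mem_gr i) m
        rw [colon_singleton_eq_self hi] at h1
        have h2 := congr(Polynomial.eval (m : ℚ) $hp)
        have h3 := hN (m + 1) (by omega)
        simp only [Polynomial.eval_sub, Polynomial.taylor_eval] at h2
        simp only [Polynomial.eval_add, Polynomial.eval_C] at ih' ⊢
        rw [h1]
        push_cast at h3 ⊢
        linarith
  · obtain ⟨p, hp⟩ := h1
    obtain ⟨q, hq⟩ := h2
    exact ⟨_, hp.add hI hf hq⟩

theorem isHilbertPolynomial_hilbertPolynomial (hI : I.IsHomogeneous (gr n k)) :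
    IsHilbertPolynomial I (hilbertPolynomial I) := by
  rw [hilbertPolynomial, dif_pos (exists_isHilbertPolynomial hI)]
  exact (exists_isHilbertPolynomial hI).choose_spec

end ProjDegree

/-! ### Leading coefficients and eventual inequalities of polynomials -/

namespace ProjDegree

section Polynomial

open Polynomial

variable {p q : ℚ[X]} {r : ℕ}

theorem leadingCoeff_nonneg_of_eventually (h : ∀ᶠ m : ℕ in Filter.atTop, 0 ≤ p.eval (m : ℚ)) :
    0 ≤ p.leadingCoeff := by
  by_contra! hlt
  have key : ∃ᶠ m : ℕ in Filter.atTop, p.eval (m : ℚ) < 0 := by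
    rcases Nat.eq_zero_or_pos p.natDegree with h0 | hpos
    · rw [Polynomial.eq_C_of_natDegree_eq_zero h0] at hlt ⊢
      rw [leadingCoeff_C] at hlt
      exact (Filter.Eventually.of_forall fun m ↦ by simpa using hlt).frequently
    · have := Polynomial.tendsto_atBot_of_leadingCoeff_nonpos p
        (natDegree_pos_iff_degree_pos.mp hpos) hlt.le
      exact ((this.comp tendsto_natCast_atTop_atTop).eventually_lt_atBot 0).frequently
  exact key (h.mono fun _ hm ↦ not_lt.mpr hm)

theorem coeff_nonneg_of_eventually (hp : p.natDegree ≤ r)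
    (h : ∀ᶠ m : ℕ in Filter.atTop, 0 ≤ p.eval (m : ℚ)) : 0 ≤ p.coeff r := by
  rcases hp.eq_or_lt with rfl | hlt
  · exact leadingCoeff_nonneg_of_eventually h
  · rw [coeff_eq_zero_of_natDegree_lt hlt]

theorem coeff_le_of_eventually (hp : p.natDegree ≤ r) (hq : q.natDegree ≤ r)
    (h : ∀ᶠ m : ℕ in Filter.atTop, p.eval (m : ℚ) ≤ q.eval (m : ℚ)) : p.coeff r ≤ q.coeff r := by
  have := coeff_nonneg_of_eventually (p := q - p) (natDegree_sub_le_of_le hq hp)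
    (h.mono fun _ hm ↦ by simpa using hm)
  simpa using this

theorem natDegree_le_of_eventually (h0 : ∀ᶠ m : ℕ in Filter.atTop, 0 ≤ p.eval (m : ℚ))
    (h : ∀ᶠ m : ℕ in Filter.atTop, p.eval (m : ℚ) ≤ q.eval (m : ℚ)) :
    p.natDegree ≤ q.natDegree := by
  by_contra! hlt
  have h1 := coeff_le_of_eventually le_rfl hlt.le h
  rw [coeff_eq_zero_of_natDegree_lt hlt] at h1
  have h2 := le_antisymm h1 (leadingCoeff_nonneg_of_eventually h0)
  have h3 : p = 0 := leadingCoeff_eq_zero.mp h2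
  simp [h3] at hlt

theorem eq_zero_of_eventually (h : ∀ᶠ m : ℕ in Filter.atTop, p.eval (m : ℚ) = 0) : p = 0 := by
  obtain ⟨N, hN⟩ := Filter.eventually_atTop.mp h
  refine Polynomial.eq_zero_of_infinite_isRoot p (Set.Infinite.mono
    (s := (fun m : ℕ => (m : ℚ)) '' Set.Ici N) ?_
      ((Set.Ici_infinite N).image Nat.cast_injective.injOn))
  rintro _ ⟨m, hm, rfl⟩
  exact hN m hm

theorem coeff_taylor_of_natDegree_le (hp : p.natDegree ≤ r) (c : ℚ) :
    (taylor c p).coeff r = p.coeff r := by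
  rcases hp.eq_or_lt with rfl | hlt
  · have := leadingCoeff_taylor c p
    rwa [leadingCoeff, natDegree_taylor] at this
  · rw [coeff_eq_zero_of_natDegree_lt hlt, coeff_eq_zero_of_natDegree_lt (by rwa [natDegree_taylor])]

theorem natDegree_sub_taylor_le (hp : p.natDegree ≤ r + 1) (c : ℚ) :
    (p - taylor c p).natDegree ≤ r := by
  rw [natDegree_le_iff_coeff_eq_zero]
  intro m hm
  rw [coeff_sub, coeff_taylor_of_natDegree_le (by omega), sub_self]

/-- The coefficient of index r in p(x - 1) is the Hasse derivative of order r at -1, and in degree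
at most r + 1 that derivative is affine linear. -/
theorem coeff_sub_taylor (hp : p.natDegree ≤ r + 1) :
    (p - taylor (-1) p).coeff r = (r + 1) * p.coeff (r + 1) := by
  have h : hasseDeriv r p = C (p.coeff r) + C ((r + 1) * p.coeff (r + 1)) * X := by
    ext m
    rw [hasseDeriv_coeff]
    rcases m with _ | _ | m
    · simp
    · simp [add_comm 1 r]
    · rw [coeff_eq_zero_of_natDegree_lt (by omega)]
      simp [coeff_one]
  rw [coeff_sub, taylor_coeff, h]
  simp

end Polynomial

/-! ### Comparison and additivity of Hilbert polynomials -/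

variable {n : ℕ} {k : Type u} [Field k] {I J p : Ideal (MvPolynomial (Fin (n + 1)) k)}

theorem hilbertPolynomial_eventually_nonneg (hI : I.IsHomogeneous (gr n k)) :
    ∀ᶠ m : ℕ in Filter.atTop, 0 ≤ (hilbertPolynomial I).eval (m : ℚ) :=
  (isHilbertPolynomial_hilbertPolynomial hI).mono fun _ hm ↦ hm ▸ Nat.cast_nonneg _

theorem hilbertPolynomial_eventually_le (hI : I.IsHomogeneous (gr n k))
    (hJ : J.IsHomogeneous (gr n k)) (h : I ≤ J) : ∀ᶠ m : ℕ in Filter.atTop,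
      (hilbertPolynomial J).eval (m : ℚ) ≤ (hilbertPolynomial I).eval (m : ℚ) := by
  filter_upwards [isHilbertPolynomial_hilbertPolynomial hI,
    isHilbertPolynomial_hilbertPolynomial hJ] with m h1 h2
  rw [h1, h2]
  exact_mod_cast hilbertFunction_anti h m

theorem natDegree_hilbertPolynomial_anti (hI : I.IsHomogeneous (gr n k))
    (hJ : J.IsHomogeneous (gr n k)) (h : I ≤ J) :
    (hilbertPolynomial J).natDegree ≤ (hilbertPolynomial I).natDegree :=
  natDegree_le_of_eventually (hilbertPolynomial_eventually_nonneg hJ)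
    (hilbertPolynomial_eventually_le hI hJ h)

theorem hilbertPolynomial_ne_zero_of_le (hI : I.IsHomogeneous (gr n k))
    (hJ : J.IsHomogeneous (gr n k)) (h : I ≤ J) (hJ0 : hilbertPolynomial J ≠ 0) :
    hilbertPolynomial I ≠ 0 := by
  intro h0
  apply hJ0
  apply eq_zero_of_eventually
  filter_upwards [hilbertPolynomial_eventually_nonneg hJ,
    hilbertPolynomial_eventually_le hI hJ h] with m h1 h2
  rw [h0, Polynomial.eval_zero] at h2
  exact le_antisymm h2 h1

theorem hilbertPolynomial_add (hI : I.IsHomogeneous (gr n k)) {f : MvPolynomial (Fin (n + 1)) k}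
    {e : ℕ} (hf : f ∈ gr n k e) : hilbertPolynomial I = hilbertPolynomial (I ⊔ Ideal.span {f}) +
      Polynomial.taylor (-(e : ℚ)) (hilbertPolynomial (I.colon {f})) :=
  (isHilbertPolynomial_hilbertPolynomial hI).unique
    ((isHilbertPolynomial_hilbertPolynomial (isHomogeneous_sup_span hI hf)).add hI hf
      (isHilbertPolynomial_hilbertPolynomial (isHomogeneous_colon hI hf)))

theorem hilbertPolynomial_sup_span [p.IsPrime] (hp : p.IsHomogeneous (gr n k))
    {f : MvPolynomial (Fin (n + 1)) k} (hf : f ∈ gr n k 1) (hfp : f ∉ p) :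
    hilbertPolynomial (p ⊔ Ideal.span {f}) =
      hilbertPolynomial p - Polynomial.taylor (-1) (hilbertPolynomial p) := by
  have := hilbertPolynomial_add hp hf
  rw [colon_singleton_eq_self hfp, Nat.cast_one] at this
  exact eq_sub_of_add_eq this.symm

/-- This singles out the irrelevant ideal, whose quotient lives in degree 0 only. If Xᵢ is outside
the prime p, all powers of Xᵢ survive in S / p. -/
theorem hilbertPolynomial_ne_zero_iff [hp : p.IsPrime] (hph : p.IsHomogeneous (gr n k)) :
    hilbertPolynomial p ≠ 0 ↔ ∃ i, MvPolynomial.X i ∉ p := by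
  constructor
  · contrapose!
    refine fun h ↦ eq_zero_of_eventually ?_
    filter_upwards [isHilbertPolynomial_hilbertPolynomial hph, Filter.eventually_ne_atTop 0]
      with m hm h0
    rw [hm, hilbertFunction_eq_zero fun f ↦ mem_of_X_mem h h0, Nat.cast_zero]
  · rintro ⟨i, hi⟩ h
    obtain ⟨m, hm⟩ := (isHilbertPolynomial_hilbertPolynomial hph).exists
    rw [h, Polynomial.eval_zero] at hm
    have := hilbertFunction_pos (I := p) (f := MvPolynomial.X i ^ m)
      (MvPolynomial.isHomogeneous_X_pow i m) fun h ↦ hi (hp.mem_of_pow_mem _ h)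
    exact this.ne (by exact_mod_cast hm)

theorem leadingCoeff_hilbertPolynomial_nonneg (hI : I.IsHomogeneous (gr n k)) :
    0 ≤ (hilbertPolynomial I).leadingCoeff :=
  leadingCoeff_nonneg_of_eventually (hilbertPolynomial_eventually_nonneg hI)

/-- The top dimensional primes over a homogeneous ideal. -/
theorem exists_isPrime_natDegree_eq (hI : I.IsHomogeneous (gr n k)) (h0 : hilbertPolynomial I ≠ 0) :
    ∃ Q : Ideal (MvPolynomial (Fin (n + 1)) k), Q.IsHomogeneous (gr n k) ∧ Q.IsPrime ∧ I ≤ Q ∧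
      hilbertPolynomial Q ≠ 0 ∧
      (hilbertPolynomial Q).natDegree = (hilbertPolynomial I).natDegree := by
  revert h0
  refine homogeneous_induction (P := fun I ↦ hilbertPolynomial I ≠ 0 →
    ∃ Q : Ideal (MvPolynomial (Fin (n + 1)) k), Q.IsHomogeneous (gr n k) ∧ Q.IsPrime ∧ I ≤ Q ∧
      hilbertPolynomial Q ≠ 0 ∧ (hilbertPolynomial Q).natDegree = (hilbertPolynomial I).natDegree)
    (fun h ↦ (h ?_).elim) (fun I hI hp _ h ↦ ⟨I, hI, hp, le_rfl, h, rfl⟩)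
    (fun I e f hI hf h1 h2 h0 ↦ ?_) I hI
  · apply eq_zero_of_eventually
    filter_upwards [isHilbertPolynomial_hilbertPolynomial (n := n) (k := k)
      (Ideal.IsHomogeneous.top _)] with m hm
    rw [hm, hilbertFunction_eq_zero fun _ _ ↦ Submodule.mem_top, Nat.cast_zero]
  have key (J : Ideal (MvPolynomial (Fin (n + 1)) k)) (hJ : hilbertPolynomial J ≠ 0)
      (hd : (hilbertPolynomial I).natDegree ≤ (hilbertPolynomial J).natDegree) (hIJ : I ≤ J)
      (h : hilbertPolynomial J ≠ 0 → ∃ Q : Ideal (MvPolynomial (Fin (n + 1)) k),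
        Q.IsHomogeneous (gr n k) ∧ Q.IsPrime ∧ J ≤ Q ∧ hilbertPolynomial Q ≠ 0 ∧
        (hilbertPolynomial Q).natDegree = (hilbertPolynomial J).natDegree) :
      ∃ Q : Ideal (MvPolynomial (Fin (n + 1)) k), Q.IsHomogeneous (gr n k) ∧ Q.IsPrime ∧ I ≤ Q ∧
        hilbertPolynomial Q ≠ 0 ∧
        (hilbertPolynomial Q).natDegree = (hilbertPolynomial I).natDegree := by
    obtain ⟨Q, hQh, hQ, hJQ, hQ0, hQd⟩ := h hJ
    exact ⟨Q, hQh, hQ, hIJ.trans hJQ, hQ0, le_antisymm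
      (natDegree_hilbertPolynomial_anti hI hQh (hIJ.trans hJQ)) (hQd ▸ hd)⟩
  have hcol : I ≤ I.colon {f} := fun x hx ↦ by
    rw [Submodule.mem_colon_singleton, smul_eq_mul]
    exact I.mul_mem_right _ hx
  -- One of I + (f) and (I : f) must have a Hilbert polynomial of at least the degree of that of I.
  -- The zero polynomial is split off because its `natDegree` is 0 too.
  have hadd := hilbertPolynomial_add hI hf
  by_cases hA : hilbertPolynomial (I ⊔ Ideal.span {f}) = 0
  · rw [hA, zero_add] at hadd
    refine key _ (fun hB ↦ h0 (by rw [hadd, hB, map_zero])) ?_ hcol h2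
    rw [hadd, Polynomial.natDegree_taylor]
  by_cases hd : (hilbertPolynomial I).natDegree ≤
      (hilbertPolynomial (I ⊔ Ideal.span {f})).natDegree
  · exact key _ hA hd le_sup_left h1
  · have hle : (hilbertPolynomial I).natDegree ≤ (hilbertPolynomial (I.colon {f})).natDegree := by
      have := Polynomial.natDegree_add_le (hilbertPolynomial (I ⊔ Ideal.span {f}))
        (Polynomial.taylor (-(e : ℚ)) (hilbertPolynomial (I.colon {f})))
      rw [← hadd, Polynomial.natDegree_taylor] at this
      omega
    refine key _ (fun hB ↦ ?_) hle hcol h2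
    rw [hB, Polynomial.natDegree_zero] at hle
    omega

theorem exists_homogeneous_mem_of_not_le [hp : p.IsPrime]
    (T : Finset (Ideal (MvPolynomial (Fin (n + 1)) k)))
    (hT : ∀ q ∈ T, q.IsHomogeneous (gr n k) ∧ ¬ q ≤ p) :
    ∃ (e : ℕ) (f : MvPolynomial (Fin (n + 1)) k), f ∈ gr n k e ∧ f ∉ p ∧ ∀ q ∈ T, f ∈ q := by
  classical
  induction T using Finset.induction_on with
  | empty => exact ⟨0, 1, MvPolynomial.isHomogeneous_one _ _, p.ne_top_iff_one.mp hp.ne_top, by simp⟩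
  | insert q T _ ih =>
    obtain ⟨e, f, hf, hfp, hfT⟩ := ih fun q hq ↦ hT q (Finset.mem_insert_of_mem hq)
    obtain ⟨hqh, hqp⟩ := hT q (Finset.mem_insert_self q T)
    obtain ⟨g, hgq, hgp⟩ := SetLike.not_le_iff_exists.mp hqp
    obtain ⟨m, hm⟩ : ∃ m, MvPolynomial.homogeneousComponent m g ∉ p := by
      by_contra! h
      apply hgp
      rw [← MvPolynomial.sum_homogeneousComponent g]
      exact Ideal.sum_mem _ fun m _ ↦ h m
    refine ⟨m + e, MvPolynomial.homogeneousComponent m g * f,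
      (MvPolynomial.homogeneousComponent_isHomogeneous m g).mul hf,
      fun h ↦ (hp.mem_or_mem h).elim hm hfp, ?_⟩
    intro q' hq'
    rcases Finset.mem_insert.mp hq' with rfl | hq'
    · exact Ideal.mul_mem_right _ _ (MvPolynomial.homogeneousComponent_mem_of_mem hqh hgq m)
    · exact Ideal.mul_mem_left _ _ (hfT q' hq')

/-- Additivity of the degree, as an inequality. -/
theorem sum_coeff_hilbertPolynomial_le {r : ℕ} (T : Finset (Ideal (MvPolynomial (Fin (n + 1)) k)))
    (hT : ∀ q ∈ T, q.IsHomogeneous (gr n k) ∧ q.IsPrime)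
    (hanti : IsAntichain (· ≤ ·) (T : Set (Ideal (MvPolynomial (Fin (n + 1)) k))))
    (hI : I.IsHomogeneous (gr n k)) (hIT : ∀ q ∈ T, I ≤ q)
    (hr : (hilbertPolynomial I).natDegree ≤ r) :
    ∑ q ∈ T, (hilbertPolynomial q).coeff r ≤ (hilbertPolynomial I).coeff r := by
  classical
  induction T using Finset.induction_on generalizing I with
  | empty => simpa using coeff_nonneg_of_eventually hr (hilbertPolynomial_eventually_nonneg hI)
  | insert p T hpT ih =>
    have hT' : ∀ q ∈ T, q.IsHomogeneous (gr n k) ∧ q.IsPrime :=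
      fun q hq ↦ hT q (Finset.mem_insert_of_mem hq)
    obtain ⟨hph, hp⟩ := hT p (Finset.mem_insert_self p T)
    -- Since f avoids p and lies in the other primes, (I : f) lies in p and I + (f) lies in the
    -- others; the exact sequence then separates the contribution of p.
    obtain ⟨e, f, hf, hfp, hfT⟩ := exists_homogeneous_mem_of_not_le (p := p) T fun q hq ↦
      ⟨(hT' q hq).1, hanti (Finset.mem_insert_of_mem hq) (Finset.mem_insert_self p T)
        (by rintro rfl; exact hpT hq)⟩
    have hsup := isHomogeneous_sup_span hI hf
    have hcol := isHomogeneous_colon hI hf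
    have hIcol : I ≤ I.colon {f} := fun x hx ↦ by
      rw [Submodule.mem_colon_singleton, smul_eq_mul]
      exact I.mul_mem_right _ hx
    have hcolp : I.colon {f} ≤ p := fun x hx ↦ by
      rw [Submodule.mem_colon_singleton, smul_eq_mul] at hx
      exact (hp.mem_or_mem (hIT p (Finset.mem_insert_self p T) hx)).resolve_right hfp
    have hcold := (natDegree_hilbertPolynomial_anti hI hcol hIcol).trans hr
    have h1 := ih hT' (hanti.subset (by simp)) hsup
      (fun q hq ↦ sup_le (hIT q (Finset.mem_insert_of_mem hq))
        ((Ideal.span_singleton_le_iff_mem _).mpr (hfT q hq)))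
      ((natDegree_hilbertPolynomial_anti hI hsup le_sup_left).trans hr)
    have h2 := coeff_le_of_eventually
      ((natDegree_hilbertPolynomial_anti hcol hph hcolp).trans hcold) hcold
      (hilbertPolynomial_eventually_le hcol hph hcolp)
    rw [Finset.sum_insert hpT, hilbertPolynomial_add hI hf, Polynomial.coeff_add,
      coeff_taylor_of_natDegree_le hcold]
    linarith

end ProjDegree

/-! ### Dimension and hyperplane sections -/

namespace ProjDegree

variable {n : ℕ} {k : Type u} [Field k] {I p Q : Ideal (MvPolynomial (Fin (n + 1)) k)}

theorem isHomogeneous_of_mem_minimalPrimes (hI : I.IsHomogeneous (gr n k))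
    (hQ : Q ∈ I.minimalPrimes) : Q.IsHomogeneous (gr n k) := by
  have hle := Q.toIdeal_homogeneousCore_le (gr n k)
  have hI' : I ≤ (Q.homogeneousCore (gr n k)).toIdeal :=
    hI.toIdeal_homogeneousCore_eq_self.symm.trans_le (Ideal.homogeneousCore_mono _ hQ.le)
  have := hQ.2 ⟨hQ.isPrime.homogeneousCore, hI'⟩ hle
  rw [le_antisymm this hle]
  exact HomogeneousIdeal.isHomogeneous _

theorem ker_constantCoeff_le (h : ∀ i, MvPolynomial.X i ∈ I) :
    RingHom.ker (MvPolynomial.constantCoeff (σ := Fin (n + 1)) (R := k)) ≤ I := by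
  intro f hf
  rw [← MvPolynomial.sum_homogeneousComponent f]
  refine Ideal.sum_mem _ fun m _ ↦ ?_
  rcases eq_or_ne m 0 with rfl | hm
  · rw [MvPolynomial.homogeneousComponent_zero]
    rw [RingHom.mem_ker, MvPolynomial.constantCoeff_eq] at hf
    rw [hf, map_zero]
    exact I.zero_mem
  · exact mem_of_X_mem h hm (MvPolynomial.homogeneousComponent_isHomogeneous m f)

theorem le_ker_constantCoeff (hI : I.IsHomogeneous (gr n k)) (hI1 : I ≠ ⊤) :
    I ≤ RingHom.ker (MvPolynomial.constantCoeff (σ := Fin (n + 1)) (R := k)) := by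
  intro f hf
  have := MvPolynomial.homogeneousComponent_mem_of_mem hI hf 0
  rw [MvPolynomial.homogeneousComponent_zero] at this
  rw [RingHom.mem_ker, MvPolynomial.constantCoeff_eq]
  by_contra h
  exact hI1 (Ideal.eq_top_of_isUnit_mem _ this ((IsUnit.mk0 _ h).map MvPolynomial.C))

theorem ringKrullDim_quotient_eq_zero [hp : p.IsPrime] (hph : p.IsHomogeneous (gr n k))
    (h0 : hilbertPolynomial p = 0) : ringKrullDim (MvPolynomial (Fin (n + 1)) k ⧸ p) = 0 := by
  have h : ∀ i, MvPolynomial.X i ∈ p := by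
    by_contra! h
    exact (hilbertPolynomial_ne_zero_iff hph).mpr h h0
  have hmax : (RingHom.ker (MvPolynomial.constantCoeff (σ := Fin (n + 1)) (R := k))).IsMaximal :=
    RingHom.ker_isMaximal_of_surjective _ fun c ↦ ⟨MvPolynomial.C c, by simp⟩
  have : p.IsMaximal := hmax.eq_of_le hp.ne_top (ker_constantCoeff_le h) ▸ hmax
  exact ringKrullDim_eq_zero_of_isField ((Ideal.Quotient.maximal_ideal_iff_isField_quotient p).mp this)

theorem hilbertPolynomial_sup_span_eq_zero [p.IsPrime] (hp : p.IsHomogeneous (gr n k))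
    {f : MvPolynomial (Fin (n + 1)) k} (hf : f ∈ gr n k 1) (hfp : f ∉ p)
    (hr : (hilbertPolynomial p).natDegree = 0) : hilbertPolynomial (p ⊔ Ideal.span {f}) = 0 := by
  rw [hilbertPolynomial_sup_span hp hf hfp, Polynomial.eq_C_of_natDegree_eq_zero hr,
    Polynomial.taylor_C, sub_self]

theorem natDegree_hilbertPolynomial_sup_span_le [p.IsPrime] (hp : p.IsHomogeneous (gr n k))
    {f : MvPolynomial (Fin (n + 1)) k} (hf : f ∈ gr n k 1) (hfp : f ∉ p) {r : ℕ}
    (hr : (hilbertPolynomial p).natDegree = r + 1) :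
    (hilbertPolynomial (p ⊔ Ideal.span {f})).natDegree ≤ r := by
  rw [hilbertPolynomial_sup_span hp hf hfp]
  exact natDegree_sub_taylor_le hr.le _

theorem coeff_hilbertPolynomial_sup_span [p.IsPrime] (hp : p.IsHomogeneous (gr n k))
    {f : MvPolynomial (Fin (n + 1)) k} (hf : f ∈ gr n k 1) (hfp : f ∉ p) {r : ℕ}
    (hr : (hilbertPolynomial p).natDegree = r + 1) :
    (hilbertPolynomial (p ⊔ Ideal.span {f})).coeff r =
      (r + 1) * (hilbertPolynomial p).leadingCoeff := by
  rw [hilbertPolynomial_sup_span hp hf hfp, coeff_sub_taylor hr.le, Polynomial.leadingCoeff, hr]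

theorem hilbertPolynomial_sup_span_ne_zero [p.IsPrime] (hp : p.IsHomogeneous (gr n k))
    {f : MvPolynomial (Fin (n + 1)) k} (hf : f ∈ gr n k 1) (hfp : f ∉ p) {r : ℕ}
    (hr : (hilbertPolynomial p).natDegree = r + 1) :
    hilbertPolynomial (p ⊔ Ideal.span {f}) ≠ 0 := by
  intro h
  have h1 := coeff_hilbertPolynomial_sup_span hp hf hfp hr
  rw [h, Polynomial.coeff_zero, eq_comm, mul_eq_zero, Polynomial.leadingCoeff_eq_zero] at h1
  rcases h1 with h1 | h1
  · exact absurd h1 (by positivity)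
  · simp [h1] at hr

theorem natDegree_hilbertPolynomial_sup_span [p.IsPrime] (hp : p.IsHomogeneous (gr n k))
    {f : MvPolynomial (Fin (n + 1)) k} (hf : f ∈ gr n k 1) (hfp : f ∉ p) {r : ℕ}
    (hr : (hilbertPolynomial p).natDegree = r + 1) :
    (hilbertPolynomial (p ⊔ Ideal.span {f})).natDegree = r := by
  refine le_antisymm (natDegree_hilbertPolynomial_sup_span_le hp hf hfp hr)
    (Polynomial.le_natDegree_of_ne_zero ?_)
  rw [coeff_hilbertPolynomial_sup_span hp hf hfp hr, mul_ne_zero_iff,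
    Polynomial.leadingCoeff_ne_zero]
  refine ⟨by positivity, ?_⟩
  rintro h
  simp [h] at hr

/-- The degree of the Hilbert polynomial of `S / p` is the dimension of `Proj (S / p)`. -/
theorem natDegree_hilbertPolynomial_add_one {r : ℕ} [hp : p.IsPrime]
    (hph : p.IsHomogeneous (gr n k)) (h0 : hilbertPolynomial p ≠ 0)
    (hr : (hilbertPolynomial p).natDegree = r) :
    ringKrullDim (MvPolynomial (Fin (n + 1)) k ⧸ p) = r + 1 := by
  induction r generalizing p with
  | zero =>
    obtain ⟨i, hi⟩ := (hilbertPolynomial_ne_zero_iff hph).mp h0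
    have hsup := isHomogeneous_sup_span hph (X_mem_gr i)
    have htop : p ⊔ Ideal.span {MvPolynomial.X i} ≠ ⊤ :=
      ne_top_of_le_ne_top (RingHom.ker_ne_top MvPolynomial.constantCoeff)
        (sup_le (le_ker_constantCoeff hph hp.ne_top)
          ((Ideal.span_singleton_le_iff_mem _).mpr (by simp)))
    -- The section has zero Hilbert polynomial, so Q is the irrelevant ideal and S / Q has dimension
    -- 0.
    obtain ⟨Q, hQ⟩ := Ideal.nonempty_minimalPrimes htop
    have := hQ.isPrime
    have hQh := isHomogeneous_of_mem_minimalPrimes hsup hQ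
    rw [ringKrullDim_quotient_eq_of_mem_minimalPrimes (k := k) hi hQ,
      ringKrullDim_quotient_eq_zero hQh, Nat.cast_zero]
    by_contra h
    exact hilbertPolynomial_ne_zero_of_le hsup hQh hQ.le h
      (hilbertPolynomial_sup_span_eq_zero hph (X_mem_gr i) hi hr)
  | succ r ih =>
    obtain ⟨i, hi⟩ := (hilbertPolynomial_ne_zero_iff hph).mp h0
    have hsup := isHomogeneous_sup_span hph (X_mem_gr i)
    have hdeg := natDegree_hilbertPolynomial_sup_span hph (X_mem_gr i) hi hr
    -- A prime Q' of full degree r over the section contains a minimal one Q. The degree for Q is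
    -- squeezed between those for Q' and for the section, both equal to r.
    obtain ⟨Q', hQ'h, hQ'p, hQ'le, hQ'0, hQ'd⟩ := exists_isPrime_natDegree_eq hsup
      (hilbertPolynomial_sup_span_ne_zero hph (X_mem_gr i) hi hr)
    obtain ⟨Q, hQ, hQQ'⟩ := Ideal.exists_minimalPrimes_le hQ'le
    have := hQ.isPrime
    have hQh := isHomogeneous_of_mem_minimalPrimes hsup hQ
    rw [ringKrullDim_quotient_eq_of_mem_minimalPrimes (k := k) hi hQ,
      ih hQh (hilbertPolynomial_ne_zero_of_le hQh hQ'h hQQ' hQ'0) (le_antisymm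
        (hdeg ▸ natDegree_hilbertPolynomial_anti hsup hQh hQ.le)
        (hdeg ▸ hQ'd ▸ natDegree_hilbertPolynomial_anti hQh hQ'h hQQ'))]
    push_cast
    rfl

/-- All components of a hyperplane section have codimension one. -/
theorem natDegree_hilbertPolynomial_of_mem_minimalPrimes [hp : p.IsPrime]
    (hph : p.IsHomogeneous (gr n k)) {f : MvPolynomial (Fin (n + 1)) k} (hf : f ∈ gr n k 1)
    (hfp : f ∉ p) (hQ : Q ∈ (p ⊔ Ideal.span {f}).minimalPrimes) (hQ0 : hilbertPolynomial Q ≠ 0) :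
    (hilbertPolynomial p).natDegree = (hilbertPolynomial Q).natDegree + 1 := by
  have := hQ.isPrime
  have hsup := isHomogeneous_sup_span hph hf
  have hQh := isHomogeneous_of_mem_minimalPrimes hsup hQ
  have hp0 := hilbertPolynomial_ne_zero_of_le hph hQh (le_sup_left.trans hQ.le) hQ0
  have h1 := ringKrullDim_quotient_eq_of_mem_minimalPrimes (k := k) hfp hQ
  rw [natDegree_hilbertPolynomial_add_one hph hp0 rfl,
    natDegree_hilbertPolynomial_add_one hQh hQ0 rfl] at h1
  have h2 : (hilbertPolynomial p).natDegree + 1 = (hilbertPolynomial Q).natDegree + 1 + 1 := by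
    exact_mod_cast h1
  omega

theorem exists_isPrime_lt [hp : p.IsPrime] (hph : p.IsHomogeneous (gr n k)) {r : ℕ}
    (hr : (hilbertPolynomial p).natDegree = r + 1) :
    ∃ Q : Ideal (MvPolynomial (Fin (n + 1)) k), Q.IsHomogeneous (gr n k) ∧ Q.IsPrime ∧ p < Q ∧
      hilbertPolynomial Q ≠ 0 ∧ (hilbertPolynomial Q).natDegree = r := by
  have h0 : hilbertPolynomial p ≠ 0 := fun h ↦ by simp [h] at hr
  obtain ⟨i, hi⟩ := (hilbertPolynomial_ne_zero_iff hph).mp h0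
  obtain ⟨Q, hQh, hQp, hQ, hQ0, hQd⟩ := exists_isPrime_natDegree_eq
    (isHomogeneous_sup_span hph (X_mem_gr i))
    (hilbertPolynomial_sup_span_ne_zero hph (X_mem_gr i) hi hr)
  refine ⟨Q, hQh, hQp, lt_of_le_of_ne (le_sup_left.trans hQ) ?_, hQ0, ?_⟩
  · rintro rfl
    exact hi (hQ (Ideal.mem_sup_right (Ideal.mem_span_singleton_self _)))
  · rw [hQd, natDegree_hilbertPolynomial_sup_span hph (X_mem_gr i) hi hr]

end ProjDegree

/-! ### Counting points on cones -/

namespace ProjDegree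

variable {n : ℕ} {k : Type u} [Field k] {I p Q : Ideal (MvPolynomial (Fin (n + 1)) k)}

/-- The degree of `Proj (S / p)` in `ℙⁿ`. -/
noncomputable def idealDegree (p : Ideal (MvPolynomial (Fin (n + 1)) k)) : ℚ :=
  ((hilbertPolynomial p).natDegree.factorial : ℚ) * (hilbertPolynomial p).leadingCoeff

/-- The common zeros of the elements of `I` in `kⁿ⁺¹`. -/
def zeros (I : Ideal (MvPolynomial (Fin (n + 1)) k)) : Set (Fin (n + 1) → k) :=
  {v | ∀ f ∈ I, MvPolynomial.eval v f = 0}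

theorem idealDegree_nonneg (hI : I.IsHomogeneous (gr n k)) : 0 ≤ idealDegree I :=
  mul_nonneg (Nat.cast_nonneg _) (leadingCoeff_hilbertPolynomial_nonneg hI)

/-- The factor r + 1 gained by the top coefficient under a linear section turns r! into (r + 1)!, so
the section has the degree of p. Only an inequality results, because multiplicities in the section
are dropped and T need not contain all its components. -/
theorem sum_idealDegree_le {r : ℕ} [hp : p.IsPrime] (hph : p.IsHomogeneous (gr n k))
    {f : MvPolynomial (Fin (n + 1)) k} (hf : f ∈ gr n k 1) (hfp : f ∉ p)
    (hr : (hilbertPolynomial p).natDegree = r + 1)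
    (T : Finset (Ideal (MvPolynomial (Fin (n + 1)) k)))
    (hT : ∀ q ∈ T, q.IsHomogeneous (gr n k) ∧ q.IsPrime ∧ (hilbertPolynomial q).natDegree = r)
    (hanti : IsAntichain (· ≤ ·) (T : Set (Ideal (MvPolynomial (Fin (n + 1)) k))))
    (hIT : ∀ q ∈ T, p ⊔ Ideal.span {f} ≤ q) : ∑ q ∈ T, idealDegree q ≤ idealDegree p := by
  have h1 := sum_coeff_hilbertPolynomial_le T (fun q hq ↦ ⟨(hT q hq).1, (hT q hq).2.1⟩) hanti
    (isHomogeneous_sup_span hph hf) hIT (natDegree_hilbertPolynomial_sup_span_le hph hf hfp hr)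
  rw [coeff_hilbertPolynomial_sup_span hph hf hfp hr] at h1
  have h2 : ∑ q ∈ T, idealDegree q = (r.factorial : ℚ) * ∑ q ∈ T, (hilbertPolynomial q).coeff r := by
    rw [Finset.mul_sum]
    refine Finset.sum_congr rfl fun q hq ↦ ?_
    rw [idealDegree, Polynomial.leadingCoeff, (hT q hq).2.2]
  rw [h2, idealDegree, hr, Nat.factorial_succ]
  push_cast
  calc (r.factorial : ℚ) * ∑ q ∈ T, (hilbertPolynomial q).coeff r
      ≤ r.factorial * ((r + 1) * (hilbertPolynomial p).leadingCoeff) := by gcongr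
    _ = _ := by ring

/-- In dimension 0 the degree is a nonzero value of the Hilbert function; in general it is at least
the degree of a component of a hyperplane section. -/
theorem one_le_idealDegree {r : ℕ} [hp : p.IsPrime] (hph : p.IsHomogeneous (gr n k))
    (h0 : hilbertPolynomial p ≠ 0) (hr : (hilbertPolynomial p).natDegree = r) :
    1 ≤ idealDegree p := by
  induction r generalizing p with
  | zero =>
    obtain ⟨m, hm⟩ := (isHilbertPolynomial_hilbertPolynomial hph).exists
    have hc := Polynomial.eq_C_of_natDegree_eq_zero hr
    rw [hc, Polynomial.eval_C] at hm
    have : (hilbertPolynomial p).leadingCoeff ≠ 0 := Polynomial.leadingCoeff_ne_zero.mpr h0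
    rw [idealDegree, hr, Nat.factorial_zero, Nat.cast_one, one_mul]
    rw [Polynomial.leadingCoeff, hr, hm] at this ⊢
    exact_mod_cast Nat.one_le_iff_ne_zero.mpr (by exact_mod_cast this)
  | succ r ih =>
    obtain ⟨i, hi⟩ := (hilbertPolynomial_ne_zero_iff hph).mp h0
    obtain ⟨Q, hQh, hQp, hQ, hQ0, hQd⟩ := exists_isPrime_natDegree_eq
      (isHomogeneous_sup_span hph (X_mem_gr i))
      (hilbertPolynomial_sup_span_ne_zero hph (X_mem_gr i) hi hr)
    rw [natDegree_hilbertPolynomial_sup_span hph (X_mem_gr i) hi hr] at hQd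
    refine (ih hQh hQ0 hQd).trans ?_
    simpa using sum_idealDegree_le hph (X_mem_gr i) hi hr {Q} (by simp [hQh, hQp, hQd])
      (by simp) (by simpa using hQ)

/-- The prime ideal of polynomials that vanish at `v`. -/
theorem isPrime_ker_eval (v : Fin (n + 1) → k) : (RingHom.ker (MvPolynomial.eval v)).IsPrime :=
  RingHom.ker_isPrime _

theorem exists_mem_minimalPrimes_mem_zeros {v : Fin (n + 1) → k} (hv : v ≠ 0) (hvI : v ∈ zeros I)
    (hI : I.IsHomogeneous (gr n k)) :
    ∃ Q ∈ I.minimalPrimes, hilbertPolynomial Q ≠ 0 ∧ v ∈ zeros Q := by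
  have := isPrime_ker_eval v
  obtain ⟨Q, hQ, hQv⟩ := Ideal.exists_minimalPrimes_le (J := RingHom.ker (MvPolynomial.eval v))
    fun f hf ↦ hvI f hf
  have := hQ.isPrime
  refine ⟨Q, hQ, ?_, fun f hf ↦ hQv hf⟩
  obtain ⟨i, hi⟩ := Function.ne_iff.mp hv
  refine (hilbertPolynomial_ne_zero_iff (isHomogeneous_of_mem_minimalPrimes hI hQ)).mpr
    ⟨i, fun h ↦ hi ?_⟩
  simpa using hQv h

theorem mem_zeros_sup_span {v : Fin (n + 1) → k} {f : MvPolynomial (Fin (n + 1)) k} :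
    v ∈ zeros (p ⊔ Ideal.span {f}) ↔ v ∈ zeros p ∧ MvPolynomial.eval v f = 0 := by
  constructor
  · exact fun h ↦ ⟨fun g hg ↦ h g (Ideal.mem_sup_left hg),
      h f (Ideal.mem_sup_right (Ideal.mem_span_singleton_self f))⟩
  · rintro ⟨h1, h2⟩
    have : p ⊔ Ideal.span {f} ≤ RingHom.ker (MvPolynomial.eval v) :=
      sup_le h1 ((Ideal.span_singleton_le_iff_mem _).mpr h2)
    exact this

/-- Counting points on a hyperplane section through its components. -/
theorem ncard_slice_le [Finite k] {r : ℕ} [hp : p.IsPrime] (hph : p.IsHomogeneous (gr n k))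
    {f : MvPolynomial (Fin (n + 1)) k} (hf : f ∈ gr n k 1) (hfp : f ∉ p)
    (hr : (hilbertPolynomial p).natDegree = r + 1) {W : Set (Fin (n + 1) → k)} (hW : 0 ∉ W)
    {C : ℚ} (hC : 0 ≤ C)
    (h : ∀ Q : Ideal (MvPolynomial (Fin (n + 1)) k), Q.IsHomogeneous (gr n k) → Q.IsPrime →
      hilbertPolynomial Q ≠ 0 → (hilbertPolynomial Q).natDegree = r →
      ((zeros Q ∩ W).ncard : ℚ) ≤ C * idealDegree Q) :
    (({v ∈ zeros p | MvPolynomial.eval v f = 0} ∩ W).ncard : ℚ) ≤ C * idealDegree p := by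
  classical
  have hsup := isHomogeneous_sup_span hph hf
  -- The filter discards the irrelevant ideal, which has no nonzero zeros and to which the purity
  -- statement does not apply.
  let T : Finset (Ideal (MvPolynomial (Fin (n + 1)) k)) :=
    (Ideal.finite_minimalPrimes_of_isNoetherianRing _ (p ⊔ Ideal.span {f})).toFinset.filter
      (hilbertPolynomial · ≠ 0)
  have hT (Q : Ideal (MvPolynomial (Fin (n + 1)) k)) :
      Q ∈ T ↔ Q ∈ (p ⊔ Ideal.span {f}).minimalPrimes ∧ hilbertPolynomial Q ≠ 0 := by simp [T]
  have hT' (Q) (hQ : Q ∈ T) : Q.IsHomogeneous (gr n k) ∧ Q.IsPrime ∧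
      (hilbertPolynomial Q).natDegree = r := by
    obtain ⟨hQ1, hQ0⟩ := (hT Q).mp hQ
    refine ⟨isHomogeneous_of_mem_minimalPrimes hsup hQ1, hQ1.isPrime, ?_⟩
    have := natDegree_hilbertPolynomial_of_mem_minimalPrimes hph hf hfp hQ1 hQ0
    omega
  have hsub : {v ∈ zeros p | MvPolynomial.eval v f = 0} ∩ W ⊆ ⋃ Q ∈ T, zeros Q ∩ W := by
    rintro v ⟨hv, hvW⟩
    obtain ⟨Q, hQ, hQ0, hvQ⟩ := exists_mem_minimalPrimes_mem_zeros (ne_of_mem_of_not_mem hvW hW)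
      (mem_zeros_sup_span.mpr hv) hsup
    exact Set.mem_biUnion ((hT Q).mpr ⟨hQ, hQ0⟩) ⟨hvQ, hvW⟩
  calc (({v ∈ zeros p | MvPolynomial.eval v f = 0} ∩ W).ncard : ℚ)
      ≤ ∑ Q ∈ T, ((zeros Q ∩ W).ncard : ℚ) := by
        exact_mod_cast (Set.ncard_le_ncard hsub (Set.toFinite _)).trans
          (Finset.set_ncard_biUnion_le T _)
    _ ≤ ∑ Q ∈ T, C * idealDegree Q := Finset.sum_le_sum fun Q hQ ↦
        h Q (hT' Q hQ).1 (hT' Q hQ).2.1 ((hT Q).mp hQ).2 (hT' Q hQ).2.2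
    _ = C * ∑ Q ∈ T, idealDegree Q := by rw [Finset.mul_sum]
    _ ≤ C * idealDegree p := by
        gcongr
        refine sum_idealDegree_le hph hf hfp hr T hT' (fun Q hQ Q' hQ' hne hle ↦ hne ?_)
          fun Q hQ ↦ ((hT Q).mp hQ).1.le
        exact le_antisymm hle
          (((hT Q').mp hQ').1.2 ⟨(hT' Q hQ).2.1, ((hT Q).mp hQ).1.le⟩ hle)

theorem slice_eq_empty [hp : p.IsPrime] (hph : p.IsHomogeneous (gr n k))
    {f : MvPolynomial (Fin (n + 1)) k} (hf : f ∈ gr n k 1) (hfp : f ∉ p)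
    (hr : (hilbertPolynomial p).natDegree = 0) {W : Set (Fin (n + 1) → k)} (hW : 0 ∉ W) :
    {v ∈ zeros p | MvPolynomial.eval v f = 0} ∩ W = ∅ := by
  have hsup := isHomogeneous_sup_span hph hf
  refine Set.eq_empty_of_forall_notMem ?_
  rintro v ⟨hv, hvW⟩
  obtain ⟨Q, hQ, hQ0, hvQ⟩ := exists_mem_minimalPrimes_mem_zeros (ne_of_mem_of_not_mem hvW hW)
    (mem_zeros_sup_span.mpr hv) hsup
  exact hilbertPolynomial_ne_zero_of_le hsup (isHomogeneous_of_mem_minimalPrimes hsup hQ) hQ.le hQ0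
    (hilbertPolynomial_sup_span_eq_zero hph hf hfp hr)

theorem one_le_natCard_sub_one [Finite k] : (1 : ℚ) ≤ (Nat.card k : ℚ) - 1 := by
  have : 2 ≤ Nat.card k := Finite.one_lt_card
  have : (2 : ℚ) ≤ Nat.card k := by exact_mod_cast this
  linarith

/-- The affine bound, for the cone over `Proj (S / p)` off the hyperplane `xᵢ = 0`. -/
theorem ncard_zeros_inter_ne_zero_le [Finite k] {r : ℕ} [hp : p.IsPrime]
    (hph : p.IsHomogeneous (gr n k)) (h0 : hilbertPolynomial p ≠ 0)
    (hr : (hilbertPolynomial p).natDegree = r) (i : Fin (n + 1)) :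
    ((zeros p ∩ {v | v i ≠ 0}).ncard : ℚ) ≤
      ((Nat.card k : ℚ) - 1) * (Nat.card k : ℚ) ^ r * idealDegree p := by
  have hk := one_le_natCard_sub_one (k := k)
  have hk' : (1 : ℚ) ≤ Nat.card k := by linarith
  let ℓ (j : Fin (n + 1)) (a : k) : MvPolynomial (Fin (n + 1)) k :=
    MvPolynomial.X j - MvPolynomial.C a * MvPolynomial.X i
  have hℓ (j a) : ℓ j a ∈ gr n k 1 :=
    (MvPolynomial.isHomogeneous_X k j).sub (MvPolynomial.isHomogeneous_C_mul_X a i)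
  have hW : (0 : Fin (n + 1) → k) ∉ {v : Fin (n + 1) → k | v i ≠ 0} := by simp
  induction r using Nat.strong_induction_on generalizing p with
  | _ r ih
  -- If every coordinate is a fixed multiple of xᵢ on the cone, a vector is determined by its
  -- nonzero i-th coordinate, and q - 1 suffices because the degree is at least 1.
  by_cases hex : ∀ j, ∃ a, ℓ j a ∈ p
  · have hle : (zeros p ∩ {v | v i ≠ 0}).ncard ≤ ({0}ᶜ : Set k).ncard := by
      refine Set.ncard_le_ncard_of_injOn (fun v ↦ v i) (fun v hv ↦ hv.2) ?_ (Set.toFinite _)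
      rintro v hv w hw (hvw : v i = w i)
      ext j
      obtain ⟨a, ha⟩ := hex j
      have h1 := hv.1 _ ha
      have h2 := hw.1 _ ha
      simp only [ℓ, map_sub, map_mul, MvPolynomial.eval_X, MvPolynomial.eval_C, sub_eq_zero] at h1 h2
      rw [h1, h2, hvw]
    rw [Set.ncard_compl, Set.ncard_singleton] at hle
    have hle' : ((zeros p ∩ {v | v i ≠ 0}).ncard : ℚ) ≤ (Nat.card k : ℚ) - 1 := by
      rw [le_sub_iff_add_le]
      have : 1 ≤ Nat.card k := Finite.card_pos
      exact_mod_cast (by omega : (zeros p ∩ {v | v i ≠ 0}).ncard + 1 ≤ Nat.card k)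
    have hd := one_le_idealDegree hph h0 hr
    calc ((zeros p ∩ {v | v i ≠ 0}).ncard : ℚ) ≤ ((Nat.card k : ℚ) - 1) * 1 * 1 := by simpa using hle'
      _ ≤ _ := by
        gcongr
        exact one_le_pow₀ hk'
  -- Otherwise some j makes every slice xⱼ = a xᵢ a proper section. The q slices cover the part with
  -- xᵢ ≠ 0, and each satisfies the bound for r - 1 with the degree of p; for r = 0 they are empty.
  push Not at hex
  obtain ⟨j, hj⟩ := hex
  have hsub : zeros p ∩ {v | v i ≠ 0} ⊆ ⋃ a ∈ (Set.toFinite (Set.univ : Set k)).toFinset,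
      {v ∈ zeros p | MvPolynomial.eval v (ℓ j a) = 0} ∩ {v | v i ≠ 0} := by
    rintro v ⟨hv, hvi⟩
    refine Set.mem_biUnion (x := v j / v i) (by simp) ⟨⟨hv, ?_⟩, hvi⟩
    have hvi' : v i ≠ 0 := hvi
    simp [ℓ, hvi']
  have hcard : (zeros p ∩ {v | v i ≠ 0}).ncard ≤ ∑ a ∈ (Set.toFinite (Set.univ : Set k)).toFinset,
      ({v ∈ zeros p | MvPolynomial.eval v (ℓ j a) = 0} ∩ {v | v i ≠ 0}).ncard :=
    (Set.ncard_le_ncard hsub (Set.toFinite _)).trans (Finset.set_ncard_biUnion_le _ _)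
  have hd := idealDegree_nonneg hph
  rcases r with _ | r
  · rw [Finset.sum_eq_zero fun a _ ↦ by rw [slice_eq_empty hph (hℓ j a) (hj a) hr hW, Set.ncard_empty],
      Nat.le_zero] at hcard
    rw [hcard, Nat.cast_zero]
    have : (0 : ℚ) ≤ (Nat.card k : ℚ) - 1 := by linarith
    positivity
  · have hC : (0 : ℚ) ≤ ((Nat.card k : ℚ) - 1) * (Nat.card k : ℚ) ^ r := by
      have : (0 : ℚ) ≤ (Nat.card k : ℚ) - 1 := by linarith
      positivity
    have hslice (a : k) := ncard_slice_le hph (hℓ j a) (hj a) hr hW hC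
      fun Q hQh hQ hQ0 hQr ↦ ih r (by omega) hQh hQ0 hQr
    calc ((zeros p ∩ {v | v i ≠ 0}).ncard : ℚ)
        ≤ ∑ a ∈ (Set.toFinite (Set.univ : Set k)).toFinset,
          (({v ∈ zeros p | MvPolynomial.eval v (ℓ j a) = 0} ∩ {v | v i ≠ 0}).ncard : ℚ) := by
          exact_mod_cast hcard
      _ ≤ ∑ a ∈ (Set.toFinite (Set.univ : Set k)).toFinset,
          ((Nat.card k : ℚ) - 1) * (Nat.card k : ℚ) ^ r * idealDegree p :=
          Finset.sum_le_sum fun a _ ↦ hslice a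
      _ = _ := by
        rw [Finset.sum_const, ← Set.ncard_eq_toFinset_card, Set.ncard_univ, nsmul_eq_mul]
        ring

/-- The bound for the cone over an integral closed subscheme of projective space. -/
theorem ncard_zeros_diff_zero_le [Finite k] {r : ℕ} [hp : p.IsPrime]
    (hph : p.IsHomogeneous (gr n k)) (h0 : hilbertPolynomial p ≠ 0)
    (hr : (hilbertPolynomial p).natDegree = r) :
    ((zeros p ∩ {0}ᶜ).ncard : ℚ) ≤ ((Nat.card k : ℚ) ^ (r + 1) - 1) * idealDegree p := by
  have hk := one_le_natCard_sub_one (k := k)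
  have hk' : (1 : ℚ) ≤ Nat.card k := by linarith
  induction r generalizing p with
  | zero | succ r ih =>
    obtain ⟨i, hi⟩ := (hilbertPolynomial_ne_zero_iff hph).mp h0
    have hsub : zeros p ∩ {0}ᶜ ⊆ (zeros p ∩ {v | v i ≠ 0}) ∪
        ({v ∈ zeros p | MvPolynomial.eval v (MvPolynomial.X i) = 0} ∩ {0}ᶜ) := by
      rintro v ⟨hv, hv0⟩
      by_cases h : v i = 0
      · exact Or.inr ⟨⟨hv, by simpa using h⟩, hv0⟩
      · exact Or.inl ⟨hv, h⟩
    have hcard : ((zeros p ∩ {0}ᶜ).ncard : ℚ) ≤ (zeros p ∩ {v | v i ≠ 0}).ncard +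
        ({v ∈ zeros p | MvPolynomial.eval v (MvPolynomial.X i) = 0} ∩ {0}ᶜ).ncard := by
      exact_mod_cast (Set.ncard_le_ncard hsub (Set.toFinite _)).trans (Set.ncard_union_le _ _)
    have haff := ncard_zeros_inter_ne_zero_le hph h0 hr i
    -- The first alternative serves r = 0, where the section by xᵢ = 0 is empty. The second serves
    -- the inductive step, where (q - 1) q^(r+1) + (q^(r+1) - 1) = q^(r+2) - 1.
    first
    | rw [slice_eq_empty hph (X_mem_gr i) hi hr (by simp), Set.ncard_empty] at hcard
      refine hcard.trans ?_
      simpa using haff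
    | have hC : (0 : ℚ) ≤ (Nat.card k : ℚ) ^ (r + 1) - 1 := sub_nonneg.mpr (one_le_pow₀ hk')
      have := ncard_slice_le hph (X_mem_gr i) hi hr (W := {0}ᶜ) (by simp) hC
        fun Q hQh hQ hQ0 hQr ↦ ih hQh hQ0 hQr
      calc _ ≤ _ := hcard
        _ ≤ _ := add_le_add haff this
        _ = _ := by ring

end ProjDegree

/-! ### Rational points and homogeneous coordinates -/

namespace ProjDegree

variable {n : ℕ} {k : Type u} [Field k]

theorem eval₂_mul_of_mem_gr {A : Type*} [CommSemiring A] (f : k →+* A) (c : A)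
    (w : Fin (n + 1) → A) {m : ℕ} {g : MvPolynomial (Fin (n + 1)) k} (hg : g ∈ gr n k m) :
    MvPolynomial.eval₂ f (fun j ↦ c * w j) g = c ^ m * MvPolynomial.eval₂ f w g := by
  rw [MvPolynomial.eval₂_eq', MvPolynomial.eval₂_eq', Finset.mul_sum]
  refine Finset.sum_congr rfl fun s hs ↦ ?_
  have h : ∑ i, s i = m := by
    rw [← hg (MvPolynomial.mem_support_iff.mp hs), Finsupp.weight_apply, Finsupp.sum_fintype]
    · simp
    · simp
  simp only [mul_pow, Finset.prod_mul_distrib, Finset.prod_pow_eq_pow_sum, h]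
  ring

/-- The vector `v` is a vector of homogeneous coordinates of the point `z`. -/
def Represents (z : projSpace n k) (v : Fin (n + 1) → k) : Prop :=
  v ≠ 0 ∧ ∀ m, ∀ f ∈ gr n k m, f ∈ z.asHomogeneousIdeal ↔ MvPolynomial.eval v f = 0

theorem Represents.eq {z z' : projSpace n k} {v : Fin (n + 1) → k} (h : Represents z v)
    (h' : Represents z' v) : z = z' :=
  ProjectiveSpectrum.ext (HomogeneousIdeal.ext' fun m f hf ↦ (h.2 m f hf).trans (h'.2 m f hf).symm)

theorem Represents.smul {z : projSpace n k} {v : Fin (n + 1) → k} (h : Represents z v) {c : k}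
    (hc : c ≠ 0) : Represents z (c • v) := by
  refine ⟨smul_ne_zero hc h.1, fun m f hf ↦ (h.2 m f hf).trans ?_⟩
  have : MvPolynomial.eval (c • v) f = c ^ m * MvPolynomial.eval v f :=
    eval₂_mul_of_mem_gr (RingHom.id k) c v hf
  rw [this, mul_eq_zero, or_iff_right (pow_ne_zero m hc)]

theorem Represents.exists_smul_eq {z : projSpace n k} {v w : Fin (n + 1) → k}
    (hv : Represents z v) (hw : Represents z w) : ∃ c : k, c ≠ 0 ∧ c • v = w := by
  obtain ⟨i, hi⟩ := Function.ne_iff.mp hv.1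
  have hi : v i ≠ 0 := hi
  have key (j : Fin (n + 1)) : v i * w j = v j * w i := by
    -- This linear form vanishes at v, so it lies in the ideal of z and vanishes at w too: v and w
    -- are proportional.
    have hmem : MvPolynomial.C (v i) * MvPolynomial.X j - MvPolynomial.C (v j) * MvPolynomial.X i ∈
        gr n k 1 := by
      simp only [MvPolynomial.C_mul']
      exact sub_mem (Submodule.smul_mem _ _ (X_mem_gr j)) (Submodule.smul_mem _ _ (X_mem_gr i))
    have := (hw.2 1 _ hmem).mp ((hv.2 1 _ hmem).mpr (by simp [mul_comm]))
    simpa [sub_eq_zero] using this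
  have h : (w i / v i) • v = w := by
    ext j
    simp only [Pi.smul_apply, smul_eq_mul]
    field_simp
    linear_combination -key j
  refine ⟨w i / v i, fun h0 ↦ hw.1 ?_, h⟩
  rw [← h, h0, zero_smul]

theorem Represents.mem_zeros {z : projSpace n k} {v : Fin (n + 1) → k} (h : Represents z v)
    {p : Ideal (MvPolynomial (Fin (n + 1)) k)} (hp : p.IsHomogeneous (gr n k))
    (hle : p ≤ z.asHomogeneousIdeal.toIdeal) : v ∈ zeros p := by
  classical
  intro f hf
  rw [← DirectSum.sum_support_decompose (gr n k) f, map_sum]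
  exact Finset.sum_eq_zero fun m _ ↦ (h.2 m _ (SetLike.coe_mem _)).mp (hle (hp m hf))

theorem exists_X_notMem (z : projSpace n k) :
    ∃ i, (MvPolynomial.X i : MvPolynomial (Fin (n + 1)) k) ∉ z.asHomogeneousIdeal.toIdeal := by
  classical
  by_contra! h
  refine z.not_irrelevant_le fun f hf ↦ ?_
  rw [← DirectSum.sum_support_decompose (gr n k) f]
  refine Ideal.sum_mem _ fun m _ ↦ ?_
  rcases eq_or_ne m 0 with rfl | hm
  · have : ((DirectSum.decompose (gr n k) f) 0 : MvPolynomial (Fin (n + 1)) k) = 0 := hf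
    rw [this]
    exact Ideal.zero_mem _
  · exact mem_of_X_mem h hm (SetLike.coe_mem _)

/-- The homogeneous coordinates `φ (Xⱼ / Xᵢ)` of a ring homomorphism `φ` out of the ring of the
chart `Xᵢ ≠ 0`. -/
noncomputable def chartCoords (i : Fin (n + 1)) {A : Type*} [CommRing A]
    (φ : HomogeneousLocalization.Away (gr n k) (MvPolynomial.X i) →+* A) (j : Fin (n + 1)) : A :=
  φ (.mk (gr n k) (X_mem_gr i) 1 (MvPolynomial.X j) (by simpa using X_mem_gr j))

theorem algebraMap_chartCoords (i j : Fin (n + 1)) :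
    algebraMap (MvPolynomial (Fin (n + 1)) k)
        (Localization.Away (MvPolynomial.X i : MvPolynomial (Fin (n + 1)) k)) (MvPolynomial.X i) *
      algebraMap (HomogeneousLocalization.Away (gr n k) (MvPolynomial.X i)) _
        (chartCoords i (RingHom.id _) j) =
      algebraMap (MvPolynomial (Fin (n + 1)) k) _ (MvPolynomial.X j) := by
  rw [HomogeneousLocalization.algebraMap_apply, chartCoords, RingHom.id_apply,
    HomogeneousLocalization.Away.val_mk, Localization.mk_eq_mk']
  simp

/-- Homogeneity gives g / Xᵢ^m = g(X₀ / Xᵢ, …, Xₙ / Xᵢ), so φ is determined by its values on scalars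
and on these ratios. -/
theorem map_awayMk (i : Fin (n + 1)) {A : Type*} [CommRing A]
    (φ : HomogeneousLocalization.Away (gr n k) (MvPolynomial.X i) →+* A) (m : ℕ)
    {g : MvPolynomial (Fin (n + 1)) k} (hg : g ∈ gr n k (m • 1)) :
    φ (.mk (gr n k) (X_mem_gr i) m g hg) =
      MvPolynomial.eval₂ ((φ.comp (HomogeneousLocalization.fromZeroRingHom (gr n k) _)).comp
        (algebraMap k (gr n k 0))) (chartCoords i φ) g := by
  have h : (HomogeneousLocalization.Away.mk (gr n k) (X_mem_gr i) m g hg) =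
      MvPolynomial.eval₂ ((HomogeneousLocalization.fromZeroRingHom (gr n k) _).comp
        (algebraMap k (gr n k 0))) (chartCoords i (RingHom.id _)) g := by
    apply HomogeneousLocalization.val_injective
    have hg' : g ∈ gr n k m := by simpa using hg
    rw [HomogeneousLocalization.Away.val_mk, ← HomogeneousLocalization.algebraMap_apply,
      MvPolynomial.hom_eval₂, Localization.mk_eq_mk', IsLocalization.mk'_eq_iff_eq_mul, map_pow,
      mul_comm, ← eval₂_mul_of_mem_gr _ _ _ hg']
    simp only [algebraMap_chartCoords]
    conv_lhs => rw [← MvPolynomial.eval₂_eta g, MvPolynomial.hom_eval₂]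
    congr 1
  rw [h, MvPolynomial.hom_eval₂]
  rfl

/-- The unique point of `Spec k`. -/
noncomputable def specPt (k : Type u) [Field k] : Spec (CommRingCat.of k) :=
  IsLocalRing.closedPoint k

theorem eq_specPt (y : Spec (CommRingCat.of k)) : y = specPt k :=
  Subsingleton.elim (α := PrimeSpectrum k) y (specPt k)

/-- A section through z gives a map from the residue field of z to k that is a left inverse of the
structure map from k. Being injective, it is the two-sided inverse, hence unique. -/
theorem RationalPoints.ext {Y : Scheme.{u}} {s : Y ⟶ Spec (CommRingCat.of k)}
    {x y : RationalPoints s}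
    (h : x.1 (specPt k) = y.1 (specPt k)) : x = y := by
  obtain ⟨x, hx⟩ := x
  obtain ⟨y, hy⟩ := y
  refine Subtype.ext ?_
  obtain ⟨⟨z, α⟩, rfl⟩ := (Scheme.SpecToEquivOfField k Y).symm.surjective x
  obtain ⟨⟨z', β⟩, rfl⟩ := (Scheme.SpecToEquivOfField k Y).symm.surjective y
  have hz : z = z' := by
    simp only [Scheme.SpecToEquivOfField_symm_apply, Scheme.Hom.comp_apply] at h
    rwa [Scheme.fromSpecResidueField_apply, Scheme.fromSpecResidueField_apply] at h
  subst hz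
  obtain ⟨σ, hσ⟩ := Spec.map_surjective (Y.fromSpecResidueField z ≫ s)
  have hα : σ ≫ α = 𝟙 _ := by
    apply Spec.map_injective
    simpa [hσ] using hx
  have hβ : σ ≫ β = 𝟙 _ := by
    apply Spec.map_injective
    simpa [hσ] using hy
  have hα' (a : k) : α (σ a) = a := congr($hα a)
  have hβ' (a : k) : β (σ a) = a := congr($hβ a)
  have : α = β := by
    ext a
    have : σ (α a) = a := α.hom.injective (hα' (α a))
    rw [← this]
    exact (hα' _).trans (hβ' _).symm
  subst this
  rfl

theorem represents_chart (i : Fin (n + 1))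
    (φ : HomogeneousLocalization.Away (gr n k) (MvPolynomial.X i) →+* k)
    (hφ : (φ.comp (HomogeneousLocalization.fromZeroRingHom (gr n k) _)).comp
        (algebraMap k (gr n k 0)) = RingHom.id k) :
    Represents ((Spec.map (CommRingCat.ofHom φ) ≫ Proj.awayι (gr n k) (MvPolynomial.X i)
      (X_mem_gr i) one_pos) (specPt k)) (chartCoords i φ) := by
  set z := (Spec.map (CommRingCat.ofHom φ) ≫ Proj.awayι (gr n k) (MvPolynomial.X i)
      (X_mem_gr i) one_pos) (specPt k) with hz
  have hi : chartCoords i φ i = 1 := by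
    rw [chartCoords, ← map_one φ]
    congr 1
    apply HomogeneousLocalization.val_injective
    simp
  have hpos {m : ℕ} (hm : 0 < m) {g : MvPolynomial (Fin (n + 1)) k} (hg : g ∈ gr n k m) :
      g ∈ z.asHomogeneousIdeal ↔ MvPolynomial.eval (chartCoords i φ) g = 0 := by
    rw [← not_iff_not]
    change z ∈ Proj.basicOpen (gr n k) g ↔ _
    have h1 : z ∈ Proj.basicOpen (gr n k) g ↔
        Spec.map (CommRingCat.ofHom φ) (specPt k) ∈
          Proj.awayι (gr n k) (MvPolynomial.X i) (X_mem_gr i) one_pos ⁻¹ᵁ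
            Proj.basicOpen (gr n k) g := by
      rw [hz, Scheme.Hom.comp_apply]
      rfl
    rw [h1, Proj.awayι_preimage_basicOpen _ _ _ hg hm]
    change ¬ φ (.mk (gr n k) (X_mem_gr i) m (g ^ 1) _) ∈ IsLocalRing.maximalIdeal k ↔ _
    rw [IsLocalRing.maximalIdeal_eq_bot, Ideal.mem_bot, map_awayMk, hφ, pow_one]
    rfl
  have hXi : MvPolynomial.X i ∉ z.asHomogeneousIdeal := by
    rw [hpos one_pos (X_mem_gr i)]
    simp [hi]
  refine ⟨fun h ↦ by simp [h] at hi, fun m f hf ↦ ?_⟩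
  -- Multiplying by Xᵢ, which is outside the prime and has value 1, reduces degree 0 to positive
  -- degree.
  have := hpos (Nat.succ_pos m) (SetLike.mul_mem_graded hf (X_mem_gr i))
  rw [map_mul, MvPolynomial.eval_X, hi, mul_one] at this
  rw [← this]
  exact ⟨fun h ↦ Ideal.mul_mem_right _ _ h, fun h ↦ (z.isPrime.mem_or_mem h).resolve_right hXi⟩

theorem chart_comp_projSpaceStr (i : Fin (n + 1))
    (φ : HomogeneousLocalization.Away (gr n k) (MvPolynomial.X i) →+* k) :
    (Spec.map (CommRingCat.ofHom φ) ≫ Proj.awayι (gr n k) (MvPolynomial.X i)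
      (X_mem_gr i) one_pos) ≫ projSpaceStr n k = 𝟙 _ ↔
    (φ.comp (HomogeneousLocalization.fromZeroRingHom (gr n k) _)).comp
        (algebraMap k (gr n k 0)) = RingHom.id k := by
  rw [projSpaceStr, Category.assoc, Proj.awayι_toSpecZero_assoc, ← Spec.map_comp, ← Spec.map_comp,
    ← Spec.map_id, Spec.map_inj]
  exact ⟨fun h ↦ congr(($h).hom), fun h ↦ CommRingCat.hom_ext h⟩

theorem RationalPoints.exists_represents (x : RationalPoints (projSpaceStr n k)) :
    ∃ v, Represents (x.1 (specPt k)) v := by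
  obtain ⟨x, hx⟩ := x
  obtain ⟨i, hi⟩ := exists_X_notMem (x (specPt k))
  obtain ⟨φ, rfl⟩ : ∃ φ : HomogeneousLocalization.Away (gr n k) (MvPolynomial.X i) →+* k,
      Spec.map (CommRingCat.ofHom φ) ≫ Proj.awayι (gr n k) (MvPolynomial.X i)
        (X_mem_gr i) one_pos = x := by
    have hr : Set.range x ⊆ Set.range (Proj.awayι (gr n k) (MvPolynomial.X i)
        (X_mem_gr i) one_pos) := by
      rintro _ ⟨y, rfl⟩
      rw [eq_specPt y]
      change _ ∈ (Proj.awayι (gr n k) (MvPolynomial.X i) (X_mem_gr i) one_pos).opensRange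
      rw [Proj.opensRange_awayι]
      exact hi
    refine ⟨(Spec.preimage (IsOpenImmersion.lift _ x hr)).hom, ?_⟩
    simp
  exact ⟨_, represents_chart i φ ((chart_comp_projSpaceStr i φ).mp hx)⟩

theorem exists_rationalPoint_represents {v : Fin (n + 1) → k} (hv : v ≠ 0) :
    ∃ x : RationalPoints (projSpaceStr n k), Represents (x.1 (specPt k)) v := by
  obtain ⟨i, hi⟩ := Function.ne_iff.mp hv
  have hi : v i ≠ 0 := hi
  let θ : Localization.Away (MvPolynomial.X i : MvPolynomial (Fin (n + 1)) k) →+* k :=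
    IsLocalization.Away.lift (MvPolynomial.X i) (g := MvPolynomial.eval v) (by simpa using hi)
  let φ : HomogeneousLocalization.Away (gr n k) (MvPolynomial.X i) →+* k :=
    θ.comp (algebraMap _ _)
  have hφ : (φ.comp (HomogeneousLocalization.fromZeroRingHom (gr n k) _)).comp
        (algebraMap k (gr n k 0)) = RingHom.id k := by
    ext a
    have h : algebraMap (HomogeneousLocalization.Away (gr n k) (MvPolynomial.X i))
        (Localization.Away (MvPolynomial.X i : MvPolynomial (Fin (n + 1)) k))
        (HomogeneousLocalization.fromZeroRingHom (gr n k) _ (algebraMap k (gr n k 0) a)) =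
        algebraMap (MvPolynomial (Fin (n + 1)) k) _ (MvPolynomial.C a) := by
      simp [HomogeneousLocalization.fromZeroRingHom]
      rfl
    simp only [RingHom.comp_apply, φ, θ, h, IsLocalization.Away.lift_eq]
    simp
  refine ⟨⟨_, (chart_comp_projSpaceStr i φ).mpr hφ⟩, ?_⟩
  have : v = v i • chartCoords i φ := by
    ext j
    have h : θ (algebraMap (MvPolynomial (Fin (n + 1)) k) _ (MvPolynomial.X i)) *
        θ (algebraMap (HomogeneousLocalization.Away (gr n k) (MvPolynomial.X i)) _
          (chartCoords i (RingHom.id _) j)) = θ (algebraMap (MvPolynomial (Fin (n + 1)) k) _ (MvPolynomial.X j)) := by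
      rw [← map_mul, algebraMap_chartCoords]
    simp only [θ, IsLocalization.Away.lift_eq, MvPolynomial.eval_X] at h
    exact h.symm
  rw [this]
  exact (represents_chart i φ hφ).smul hi

theorem natCast_card_units [Finite k] : (Nat.card kˣ : ℚ) = Nat.card k - 1 := by
  rw [Nat.card_units, Nat.cast_sub Nat.card_pos, Nat.cast_one]

/-- A rational point and a unit give a multiple of a chosen coordinate vector; the vector determines
the point of ℙⁿ, hence the section, and then the unit. -/
theorem card_rationalPoints_mul_le [Finite k] {X : Scheme.{u}} (i : X ⟶ projSpace n k) [Mono i] :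
    Finite (RationalPoints (i ≫ projSpaceStr n k)) ∧
      (Nat.card (RationalPoints (i ≫ projSpaceStr n k)) : ℚ) * (Nat.card k - 1) ≤
        ({v | ∃ x : X, Represents (i x) v} : Set (Fin (n + 1) → k)).ncard := by
  let F (f : RationalPoints (i ≫ projSpaceStr n k)) : RationalPoints (projSpaceStr n k) :=
    ⟨f.1 ≫ i, by rw [Category.assoc, f.2]⟩
  have hF : Function.Injective F := fun f g h ↦
    Subtype.ext ((cancel_mono i).mp congr(($h).1))
  choose w hw using RationalPoints.exists_represents (n := n) (k := k)
  let T : Set (Fin (n + 1) → k) := {v | ∃ x : X, Represents (i x) v}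
  let G (a : RationalPoints (i ≫ projSpaceStr n k) × kˣ) : T :=
    ⟨(a.2 : k) • w (F a.1), a.1.1 (specPt k), (hw (F a.1)).smul a.2.ne_zero⟩
  have hG : Function.Injective G := by
    rintro ⟨f, c⟩ ⟨g, e⟩ h
    have h : (c : k) • w (F f) = (e : k) • w (F g) := congr(($h).1)
    have h1 := (hw (F f)).smul c.ne_zero
    rw [h] at h1
    obtain rfl : f = g := hF (RationalPoints.ext (h1.eq ((hw (F g)).smul e.ne_zero)))
    have := smul_left_injective k (hw (F f)).1 h
    rw [Units.ext this]
  have := Finite.of_injective G hG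
  refine ⟨Finite.of_injective (fun f ↦ (f, (1 : kˣ))) fun f g h ↦ congr(($h).1), ?_⟩
  have := Nat.card_le_card_of_injective G hG
  rw [Nat.card_prod, Nat.card_coe_set_eq] at this
  rw [← natCast_card_units]
  exact_mod_cast this

/-- Conversely, a nonzero vector is recovered from the rational point it represents and its ratio to
the chosen coordinate vector of that point. -/
theorem pow_sub_one_le_card_rationalPoints_mul [Finite k] :
    (Nat.card k : ℚ) ^ (n + 1) - 1 ≤
      (Nat.card (RationalPoints (projSpaceStr n k)) : ℚ) * (Nat.card k - 1) := by
  have hfin : Finite (RationalPoints (projSpaceStr n k)) := by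
    have := (card_rationalPoints_mul_le (𝟙 (projSpace n k))).1
    rwa [Category.id_comp] at this
  choose w hw using RationalPoints.exists_represents (n := n) (k := k)
  choose x hx using fun v : {v : Fin (n + 1) → k // v ≠ 0} ↦ exists_rationalPoint_represents v.2
  choose c hc0 hc using fun v ↦ (hw (x v)).exists_smul_eq (hx v)
  have hG : Function.Injective fun v ↦ (x v, Units.mk0 (c v) (hc0 v)) := by
    intro v v' h
    have h1 : x v = x v' := congr(($h).1)
    have h2 : c v = c v' := congr((($h).2 : k))
    rw [← Subtype.coe_inj, ← hc v, ← hc v', h1, h2]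
  have h := Nat.card_le_card_of_injective _ hG
  rw [Nat.card_prod] at h
  have h0 : Nat.card {v : Fin (n + 1) → k // v ≠ 0} + 1 = Nat.card k ^ (n + 1) := by
    classical
    have := Fintype.ofFinite k
    rw [Nat.card_eq_fintype_card, Fintype.card_subtype_compl, Fintype.card_subtype_eq,
      Nat.sub_add_cancel Fintype.card_pos]
    simp
  have h0 : (Nat.card {v : Fin (n + 1) → k // v ≠ 0} : ℚ) + 1 = (Nat.card k : ℚ) ^ (n + 1) := by
    exact_mod_cast h0
  rw [← natCast_card_units, ← h0, add_sub_cancel_right]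
  exact_mod_cast h

/-! ### Components, multiplicities and dimension of the subscheme -/

instance : Algebra.FiniteType (gr n k 0) (MvPolynomial (Fin (n + 1)) k) :=
  have : IsScalarTower k (gr n k 0) (MvPolynomial (Fin (n + 1)) k) :=
    ⟨fun a b c ↦ smul_mul_assoc a (b : MvPolynomial (Fin (n + 1)) k) c⟩
  Algebra.FiniteType.of_restrictScalars_finiteType k _ _

instance : IsNoetherian (projSpace n k) where
  toIsLocallyNoetherian :=
    LocallyOfFiniteType.isLocallyNoetherian (Proj.toSpecZero (gr n k))
  toCompactSpace := QuasiCompact.compactSpace_of_compactSpace (Proj.toSpecZero (gr n k))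

theorem isNoetherian_of_isClosedImmersion {X Y : Scheme.{u}} (i : X ⟶ Y) [IsClosedImmersion i]
    [IsNoetherian Y] : IsNoetherian X where
  toIsLocallyNoetherian := LocallyOfFiniteType.isLocallyNoetherian i
  toCompactSpace := QuasiCompact.compactSpace_of_compactSpace i

/-- The local ring at a generic point is Artinian and nonzero. Finiteness of its length matters,
since `toNat` sends infinite length to 0. -/
theorem one_le_multiplicity {X : Scheme.{u}} [IsLocallyNoetherian X] {x : X}
    (hx : x ∈ genericPoints X) : 1 ≤ multiplicity X x := by
  have hmax : IsMax x := by
    intro y hy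
    have hy : y ⤳ x := hy
    have h := hx.2 (y := closure {y}) isIrreducible_singleton.closure
      (specializes_iff_closure_subset.mp hy)
    exact specializes_iff_closure_subset.mpr h
  have : Ring.KrullDimLE 0 (X.presheaf.stalk x) :=
    krullDimLE_of_coheight_le (by simp [Order.coheight_eq_zero.mpr hmax])
  have : IsArtinianRing (X.presheaf.stalk x) :=
    IsNoetherianRing.isArtinianRing_of_krullDimLE_zero
  rw [Nat.one_le_iff_ne_zero, multiplicity, ne_eq, ENat.toNat_eq_zero, not_or]
  exact ⟨Module.length_pos.ne', Module.length_ne_top⟩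

theorem hilbertPolynomial_asHomogeneousIdeal_ne_zero (z : projSpace n k) :
    hilbertPolynomial z.asHomogeneousIdeal.toIdeal ≠ 0 :=
  have := z.isPrime
  (hilbertPolynomial_ne_zero_iff z.asHomogeneousIdeal.isHomogeneous).mpr (exists_X_notMem z)

theorem specializes_iff_le {z z' : projSpace n k} :
    z ⤳ z' ↔ z.asHomogeneousIdeal.toIdeal ≤ z'.asHomogeneousIdeal.toIdeal :=
  specializes_iff_mem_closure.trans (ProjectiveSpectrum.le_iff_mem_closure _ z z').symm

/-- In the order used here specializations are smaller, so the height of x measures chains in its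
closure. Repeated hyperplane sections give such a chain, which stays in X because the image is
closed. -/
theorem le_height {X : Scheme.{u}} (i : X ⟶ projSpace n k) [IsClosedImmersion i] (r : ℕ) (x : X)
    (hr : (hilbertPolynomial (i x).asHomogeneousIdeal.toIdeal).natDegree = r) :
    (r : ℕ∞) ≤ Order.height x := by
  induction r generalizing x with
  | zero => simp
  | succ r ih =>
    have := (i x).isPrime
    obtain ⟨Q, hQ, hQp, hlt, h0, hr'⟩ :=
      exists_isPrime_lt (i x).asHomogeneousIdeal.isHomogeneous hr
    obtain ⟨j, hj⟩ := (hilbertPolynomial_ne_zero_iff hQ).mp h0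
    let z : projSpace n k := ⟨⟨Q, hQ⟩, hQp, fun h ↦ hj <| h <| by
      exact DirectSum.decompose_of_mem_ne (gr n k) (X_mem_gr j) one_ne_zero⟩
    have hz : i x ⤳ z := specializes_iff_le.mpr hlt.le
    have hemb := i.isClosedEmbedding
    obtain ⟨y, hy⟩ : z ∈ Set.range i := hz.mem_closed hemb.isClosed_range ⟨x, rfl⟩
    have hle : y ≤ x := by
      rw [Scheme.le_iff_specializes, ← hemb.isInducing.specializes_iff, hy]
      exact hz
    have hnle : ¬ x ≤ y := by
      rw [Scheme.le_iff_specializes, ← hemb.isInducing.specializes_iff, hy, specializes_iff_le]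
      exact hlt.not_ge
    calc ((r + 1 : ℕ) : ℕ∞) = r + 1 := by push_cast; rfl
      _ ≤ Order.height y + 1 := by gcongr; exact ih y (by rw [hy]; exact hr')
      _ ≤ Order.height x := Order.height_add_one_le (lt_of_le_not_ge hle hnle)

theorem natDegree_le_of_topologicalKrullDim_eq {X : Scheme.{u}} (i : X ⟶ projSpace n k)
    [IsClosedImmersion i] {d : ℕ} (hd : topologicalKrullDim X = d) (x : X) :
    (hilbertPolynomial (i x).asHomogeneousIdeal.toIdeal).natDegree ≤ d := by
  have h := Order.height_le_krullDim x
  rw [← Order.krullDim_eq_of_orderIso irreducibleSetEquivPoints, ← topologicalKrullDim, hd] at h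
  have h' : Order.height x ≤ (d : ℕ∞) := by exact_mod_cast h
  exact_mod_cast (le_height i _ x rfl).trans h'

theorem ncard_represents_le [Finite k] {X : Scheme.{u}} (i : X ⟶ projSpace n k)
    [IsClosedImmersion i] {d : ℕ} (hd : topologicalKrullDim X = d) :
    (({v | ∃ x : X, Represents (i x) v} : Set (Fin (n + 1) → k)).ncard : ℚ) ≤
      ((Nat.card k : ℚ) ^ (d + 1) - 1) * degree i := by
  have : IsNoetherian X := isNoetherian_of_isClosedImmersion i
  have hfin : Finite (genericPoints X) :=
    genericPoints.finite finite_irreducibleComponents_of_isNoetherian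
  have := Fintype.ofFinite (genericPoints X)
  have hk := one_le_natCard_sub_one (k := k)
  have hk' : (1 : ℚ) ≤ Nat.card k := by linarith
  let p (x : X) := (i x).asHomogeneousIdeal.toIdeal
  have hsub : {v : Fin (n + 1) → k | ∃ x : X, Represents (i x) v} ⊆
      ⋃ η ∈ (Finset.univ : Finset (genericPoints X)), zeros (p η.1) ∩ {0}ᶜ := by
    rintro v ⟨x, hx⟩
    let η := genericPoints.ofComponent
      ⟨irreducibleComponent x, irreducibleComponent_mem_irreducibleComponents x⟩
    have hη : η.1 ⤳ x := by
      rw [specializes_iff_mem_closure,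
        (genericPoints.isGenericPoint_ofComponent ⟨irreducibleComponent x, _⟩).def]
      exact mem_irreducibleComponent
    refine Set.mem_biUnion (Finset.mem_coe.mpr (Finset.mem_univ η)) ⟨?_, hx.1⟩
    exact hx.mem_zeros (i η.1).asHomogeneousIdeal.isHomogeneous
      (specializes_iff_le.mp (hη.map i.continuous))
  calc (({v : Fin (n + 1) → k | ∃ x : X, Represents (i x) v}).ncard : ℚ)
      ≤ ∑ η : genericPoints X, ((zeros (p η.1) ∩ {0}ᶜ).ncard : ℚ) := by
        exact_mod_cast (Set.ncard_le_ncard hsub (Set.toFinite _)).trans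
          (Finset.set_ncard_biUnion_le _ _)
    -- For each component the exponent is raised from its own dimension to d and the multiplicity,
    -- at least 1, is inserted; this is where X may fail to be equidimensional or reduced.
    _ ≤ ∑ η : genericPoints X, ((Nat.card k : ℚ) ^ (d + 1) - 1) *
          ((multiplicity X η.1 : ℚ) * degreeOfClosure (i η.1)) := by
        refine Finset.sum_le_sum fun η _ ↦ ?_
        have := (i η.1).isPrime
        have hph := (i η.1).asHomogeneousIdeal.isHomogeneous
        have he : 0 ≤ degreeOfClosure (i η.1) := idealDegree_nonneg hph
        have hm : (1 : ℚ) ≤ multiplicity X η.1 := by exact_mod_cast one_le_multiplicity η.2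
        have hpow := pow_le_pow_right₀ hk'
          (Nat.succ_le_succ (natDegree_le_of_topologicalKrullDim_eq i hd η.1))
        calc ((zeros (p η.1) ∩ {0}ᶜ).ncard : ℚ)
            ≤ ((Nat.card k : ℚ) ^ ((hilbertPolynomial (p η.1)).natDegree + 1) - 1) *
                degreeOfClosure (i η.1) :=
              ncard_zeros_diff_zero_le hph (hilbertPolynomial_asHomogeneousIdeal_ne_zero _) rfl
          _ ≤ ((Nat.card k : ℚ) ^ (d + 1) - 1) * degreeOfClosure (i η.1) := by
              gcongr
          _ ≤ _ := by
              refine mul_le_mul_of_nonneg_left (le_mul_of_one_le_left he hm) ?_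
              exact sub_nonneg.mpr (one_le_pow₀ hk')
    _ = _ := by rw [← Finset.mul_sum, degree, finsum_eq_sum_of_fintype]

theorem degree_nonneg {X : Scheme.{u}} (i : X ⟶ projSpace n k) : 0 ≤ degree i :=
  finsum_nonneg fun x ↦ mul_nonneg (Nat.cast_nonneg _)
    (idealDegree_nonneg (i x.1).asHomogeneousIdeal.isHomogeneous)

end ProjDegree

theorem mainTheorem8 {k : Type u} [Field k] [Finite k] (n d : ℕ) (X : Scheme.{u})
    (i : X ⟶ ProjDegree.projSpace n k) [IsClosedImmersion i]
    (hd : topologicalKrullDim X = (d : WithBot ℕ∞)) :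
    Finite (ProjDegree.RationalPoints (i ≫ ProjDegree.projSpaceStr n k)) ∧
      (Nat.card (ProjDegree.RationalPoints (i ≫ ProjDegree.projSpaceStr n k)) : ℚ) ≤
        (Nat.card (ProjDegree.RationalPoints (ProjDegree.projSpaceStr d k)) : ℚ) *
          ProjDegree.degree i := by
  obtain ⟨hfin, hle⟩ := ProjDegree.card_rationalPoints_mul_le i
  have hk := ProjDegree.one_le_natCard_sub_one (k := k)
  refine ⟨hfin, le_of_mul_le_mul_right ?_ (zero_lt_one.trans_le hk)⟩
  calc _ ≤ _ := hle
    _ ≤ _ := ProjDegree.ncard_represents_le i hd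
    _ ≤ _ := mul_le_mul_of_nonneg_right ProjDegree.pow_sub_one_le_card_rationalPoints_mul
      (ProjDegree.degree_nonneg i)
    _ = _ := by ring
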